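/- **Theorem 3.1.** Homogeneous coordinates on $\mathbb P^2=\mathbb P^2_{\mathbb C}$ are $(x:y:z)$. A foliation $\mathcal H$ of degree $d$ on $\mathbb P^2$ is *homogeneous* if, in suitable affine coordinates, it is defined by a 1-form $A\,dx+B\,dy$ with $A,B\in\mathbb C[x,y]$ homogeneous of degree $d$ and coprime; it is *convex* if every component of its inflection divisor is invariant. (If $\mathcal H$ is given by a vector field $X$ on $\mathbb C^3$ homogeneous of degree $d$, the inflection divisor is $\det\bigl((x,y,z),(X(x),X(y),X(z)),(X^2(x),X^2(y),X^2(z))\bigr)=0$.) A singularity of $\mathcal H$ is *radial of order $k\ge 1$* if its algebraic multiplicity is $1$ and $\mathcal H$ has tangency order $k+1$ there with a generic line through it. The *type* of $\mathcal H$ is $\mathcal T_{\mathcal H}=\sum_{k=1}^{d-1}(r_kR_k+t_kT_k)$, a polynomial in indeterminates $R_k,T_k$, where $r_k$ is the number of radial singularities of order $k$ and $t_k$ the number of non-invariant lines of multiplicity $k$ in the inflection divisor; $\deg\mathcal T_{\mathcal H}=\sum_k(r_k+t_k)$ (for convex $\mathcal H$ all $t_k$ vanish). Let $d\ge 3$ and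 $$N_d=\left\lfloor\tfrac{d+1}{3}\right\rfloor+\sum_{l=1}^{\lfloor d/3\rfloor}\left\lfloor\tfrac{d-3l+2}{2}\right\rfloor-\varepsilon_d,\qquad \varepsilon_d=\begin{cases}0,& d\equiv 1 \pmod 3,\\ 1,& d\not\equiv 1 \pmod 3.\end{cases}$$ Put $$A^d_l=-x^{l-1}y^{d-l+1}+\sum_{i=2}^{l}(-1)^i\binom{l-1}{i-1}\prod_{j=2}^{i}\frac{d-2l+j}{d-l+j}\;x^{l-i}y^{d-l+i},$$ $$B^d_l=x^{d-l+1}y^{l-1}+\sum_{i=2}^{l}(-1)^{i-1}\binom{l-1}{i-1}\prod_{j=2}^{i}\frac{d-2l+j}{d-l+j}\;x^{d-l+i}y^{l-i},$$ $$C^d_{l,\nu}=\Bigl(\prod_{j=l}^{\nu-l+1}\frac{d-\nu+j}{j}\Bigr)\sum_{i=0}^{\nu-l+1}(-1)^{i+1}\binom{\nu-l+1}{i}\prod_{j=1}^{i}\frac{d-\nu+j-1}{d-\nu+l+j-1}\;x^{\nu-l+1-i}y^{d-\nu+l-1+i},$$ $$D^d_{l,\nu}=x^{d-l+1}y^{l-1}+\sum_{i=2}^{l}(-1)^{i-1}\binom{l-1}{i-1}\prod_{j=2}^{i}\frac{d-\nu+j-2}{d-l+j}\;x^{d-l+i}y^{l-i}.$$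 Up to projective linear automorphisms of $\mathbb P^2$, there are exactly $N_d$ homogeneous convex foliations $\mathcal H$ of degree $d$ on $\mathbb P^2$ with $\deg\mathcal T_{\mathcal H}=3$. Each of them is conjugate to the foliation given by one of the following forms, and each of these forms defines such a foliation, of the indicated type: (i) $\omega^d_l=A^d_l\,dx+B^d_l\,dy$, of type $R_{2l-2}+2R_{d-l}$, where $2\le l\le\frac{d+1}{3}$; or of type $3R_{d-l}$, when $d=3l-2$; (ii) $\omega^d_{l,\nu}=C^d_{l,\nu}\,dx+D^d_{l,\nu}\,dy$, of type $R_\nu+R_{d-\nu+l-2}+R_{d-l}$, where $1\le l\le\frac d3$ and $2l-1\le\nu\le\frac{d+l-2}{2}$. -/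

import Mathlib

open MvPolynomial

noncomputable section

namespace ConvexFol

/-! ## Foliations of the complex projective plane

A degree `d` foliation of `ℙ²` is given by a vector field `V` on `ℂ³` whose three components are
homogeneous polynomials of degree `d`; the associated homogeneous 1-form is
`ω_V = i_R i_V (dx ∧ dy ∧ dz)` (`R` the radial field), up to sign, i.e. the cross product of the
position vector with `V`.  Two fields define the same foliation iff their 1-forms are proportional.
The homogeneous coordinates are `x = X 0`, `y = X 1`, `z = X 2`. -/

/-- Polynomial vector fields (and also polynomial 1-forms) on `ℂ³`, as triples of coefficients. -/
abbrev Triple := Fin 3 → MvPolynomial (Fin 3) ℂ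

/-- The homogeneous 1-form `ω_V = (x, y, z) × V` defined by a vector field `V`. -/
def formOf (V : Triple) : Triple :=
  crossProduct (fun i => (X i : MvPolynomial (Fin 3) ℂ)) V

/-- `V` defines a foliation of degree `d` on `ℙ²`: its components are homogeneous of degree `d`
and its 1-form has isolated zeros (its coefficients have no common factor). -/
def IsFoliation (d : ℕ) (V : Triple) : Prop :=
  (∀ i, (V i).IsHomogeneous d) ∧
    ∀ g : MvPolynomial (Fin 3) ℂ, (∀ i, g ∣ formOf V i) → IsUnit g

/-- The derivative `V(f)` of a polynomial `f` along `V`. -/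
def lieD (V : Triple) (f : MvPolynomial (Fin 3) ℂ) : MvPolynomial (Fin 3) ℂ :=
  ∑ i, V i * pderiv i f

/-- The curve `h = 0` is invariant by the foliation. -/
def IsInvariantCurve (V : Triple) (h : MvPolynomial (Fin 3) ℂ) : Prop :=
  h ∣ lieD V h

/-! ## Linear conjugacy -/

/-- The linear substitution `f ↦ f(M p)`. -/
def linSubst (M : Matrix (Fin 3) (Fin 3) ℂ) :
    MvPolynomial (Fin 3) ℂ →ₐ[ℂ] MvPolynomial (Fin 3) ℂ :=
  aeval fun i => ∑ j, C (M i j) * X j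

/-- The pull-back `M^* ω` of the 1-form `ω` under the linear map `p ↦ M p`. -/
def pullback (M : Matrix (Fin 3) (Fin 3) ℂ) (ω : Triple) : Triple :=
  fun i => ∑ j, C (M j i) * linSubst M (ω j)

/-- The foliations defined by `V` and `W` are conjugate by a projective linear automorphism of
`ℙ²`. -/
def Conj (V W : Triple) : Prop :=
  ∃ (M : GL (Fin 3) ℂ) (c : ℂˣ), formOf W = fun i => C (c : ℂ) * pullback M (formOf V) i

theorem linSubst_X (M : Matrix (Fin 3) (Fin 3) ℂ) (i : Fin 3) :
    linSubst M (X i) = ∑ j, C (M i j) * X j := by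
  simp [linSubst]

theorem linSubst_one : linSubst 1 = AlgHom.id ℂ _ := by
  apply MvPolynomial.algHom_ext
  intro i
  rw [linSubst_X]
  simp [Matrix.one_apply]

theorem linSubst_mul (M N : Matrix (Fin 3) (Fin 3) ℂ) (f : MvPolynomial (Fin 3) ℂ) :
    linSubst (M * N) f = linSubst N (linSubst M f) := by
  have : linSubst (M * N) = (linSubst N).comp (linSubst M) := by
    apply MvPolynomial.algHom_ext
    intro i
    rw [AlgHom.comp_apply, linSubst_X, linSubst_X, map_sum]
    simp only [map_mul, linSubst_X, ← algebraMap_eq, AlgHom.commutes]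
    simp only [algebraMap_eq, Matrix.mul_apply, C_add, C_mul, Fin.sum_univ_three]
    ring
  rw [this, AlgHom.comp_apply]

theorem pullback_one (ω : Triple) : pullback 1 ω = ω := by
  funext i
  simp [pullback, linSubst_one, Matrix.one_apply]

theorem pullback_mul (M N : Matrix (Fin 3) (Fin 3) ℂ) (ω : Triple) :
    pullback (M * N) ω = pullback N (pullback M ω) := by
  funext i
  simp only [pullback, linSubst_mul, map_sum, map_mul, ← algebraMap_eq, AlgHom.commutes]
  simp only [algebraMap_eq, Matrix.mul_apply, C_add, C_mul, Fin.sum_univ_three]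
  ring

theorem pullback_smul (M : Matrix (Fin 3) (Fin 3) ℂ) (c : ℂ) (ω : Triple) :
    pullback M (fun i => C c * ω i) = fun i => C c * pullback M ω i := by
  funext i
  simp only [pullback, map_mul, ← algebraMap_eq, AlgHom.commutes]
  simp only [algebraMap_eq, Fin.sum_univ_three]
  ring

theorem conj_equivalence : Equivalence Conj where
  refl V := ⟨1, 1, by simp [pullback_one]⟩
  symm := by
    rintro V W ⟨M, c, h⟩
    refine ⟨M⁻¹, c⁻¹, ?_⟩
    rw [h, pullback_smul, ← pullback_mul, ← Units.val_mul, mul_inv_cancel, Units.val_one,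
      pullback_one]
    funext i
    rw [← mul_assoc, ← C_mul, ← Units.val_mul, inv_mul_cancel, Units.val_one, C_1, one_mul]
  trans := by
    rintro U V W ⟨M, c, h⟩ ⟨N, e, k⟩
    refine ⟨M * N, e * c, ?_⟩
    rw [k, h, pullback_smul, Units.val_mul, Units.val_mul, pullback_mul]
    funext i
    rw [← mul_assoc, ← C_mul]

/-- Linear conjugacy as an equivalence relation. -/
def conjSetoid : Setoid Triple := ⟨Conj, conj_equivalence⟩

/-! ## Homogeneous foliations -/

/-- The foliation of `ℙ²` given in the affine chart `z = 1` by the 1-form `A dx + B dy`,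
equivalently by the vector field `B ∂_x - A ∂_y`, where `A`, `B` are binary forms of the
same degree. Its homogeneous 1-form is `z A dx + z B dy - (x A + y B) dz`. -/
def affineForm (A B : MvPolynomial (Fin 2) ℂ) : Triple :=
  ![rename Fin.castSucc B, -rename Fin.castSucc A, 0]

/-- In suitable affine coordinates the foliation is given by `A dx + B dy` with `A`, `B`
homogeneous of degree `d` and coprime. -/
def IsHomogeneousFoliation (d : ℕ) (V : Triple) : Prop :=
  ∃ A B : MvPolynomial (Fin 2) ℂ, A.IsHomogeneous d ∧ B.IsHomogeneous d ∧ IsRelPrime A B ∧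
    Conj (affineForm A B) V

/-! ## Inflection divisor, convexity -/

/-- The equation of the inflection divisor: the determinant with rows `(x, y, z)`,
`(V(x), V(y), V(z))`, `(V²(x), V²(y), V²(z))`. -/
def inflection (V : Triple) : MvPolynomial (Fin 3) ℂ :=
  Matrix.det (Matrix.of ![fun i => X i, fun i => lieD V (X i), fun i => lieD V (lieD V (X i))])

/-- A foliation is convex if every component of its inflection divisor is invariant. -/
def IsConvex (V : Triple) : Prop :=
  ∀ h, Irreducible h → h ∣ inflection V → IsInvariantCurve V h

/-! ## Radial singularities and the type -/

/-- The restriction of the 1-form to the parametrized line `t ↦ v + t w`, i.e. the polynomial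
`ω_{v + t w}(w)` in `t`.  Its order at `t = 0` is the tangency order, at the point `[v]`, of the
foliation with the line joining `[v]` and `[w]` (if `w` is a multiple of `v`, it is zero). -/
def lineRestriction (V : Triple) (v w : Fin 3 → ℂ) : Polynomial ℂ :=
  ∑ i, aeval (fun k => Polynomial.C (v k) + Polynomial.C (w k) * Polynomial.X) (formOf V i)
    * Polynomial.C (w i)

/-- `[v]` is a radial singularity of order `k ≥ 1`: it is a singularity of algebraic
multiplicity one, and the tangency order at `[v]` between the foliation and a generic line through
`[v]` (the least such order over all lines through `[v]`) is `k + 1`. -/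
def IsRadial (V : Triple) (v : Fin 3 → ℂ) (k : ℕ) : Prop :=
  1 ≤ k ∧ (∀ i, eval v (formOf V i) = 0) ∧ (∃ i j, eval v (pderiv j (formOf V i)) ≠ 0) ∧
    (∀ w, Polynomial.X ^ (k + 1) ∣ lineRestriction V v w) ∧
    ∃ w, ¬ Polynomial.X ^ (k + 2) ∣ lineRestriction V v w

/-- `r_k`: the number of radial singularities of order `k` in `ℙ²`. -/
def radialCount (V : Triple) (k : ℕ) : ℕ :=
  Set.ncard {s : Projectivization ℂ (Fin 3 → ℂ) | IsRadial V s.rep k}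

/-- The linear form with coefficients `a`. -/
def linForm (a : Fin 3 → ℂ) : MvPolynomial (Fin 3) ℂ := ∑ i, C (a i) * X i

/-- `t_k`: the number of non-invariant lines of multiplicity `k` in the inflection divisor
(transverse inflection lines of order `k`).  Lines are points of the dual plane. -/
def transverseCount (V : Triple) (k : ℕ) : ℕ :=
  Set.ncard {a : Projectivization ℂ (Fin 3 → ℂ) |
    ¬ IsInvariantCurve V (linForm a.rep) ∧
      emultiplicity (linForm a.rep) (inflection V) = (k : ℕ∞)}

/-- The indeterminate `R_k`. -/
def R (k : ℕ) : MvPolynomial (ℕ ⊕ ℕ) ℤ := X (Sum.inl k)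

/-- The indeterminate `T_k`. -/
def T (k : ℕ) : MvPolynomial (ℕ ⊕ ℕ) ℤ := X (Sum.inr k)

/-- The type `∑_{k=1}^{d-1} (r_k R_k + t_k T_k)` of a homogeneous foliation of degree `d`. -/
def folType (d : ℕ) (V : Triple) : MvPolynomial (ℕ ⊕ ℕ) ℤ :=
  ∑ k ∈ Finset.Icc 1 (d - 1),
    ((radialCount V k : MvPolynomial (ℕ ⊕ ℕ) ℤ) * R k
      + (transverseCount V k : MvPolynomial (ℕ ⊕ ℕ) ℤ) * T k)

/-- The degree `∑_{k=1}^{d-1} (r_k + t_k)` of the type. -/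
def typeDegree (d : ℕ) (V : Triple) : ℕ :=
  ∑ k ∈ Finset.Icc 1 (d - 1), (radialCount V k + transverseCount V k)

/-- `V` defines a homogeneous convex foliation of degree `d` on `ℙ²` with type of degree three. -/
def IsHomConvexType3 (d : ℕ) (V : Triple) : Prop :=
  IsFoliation d V ∧ IsHomogeneousFoliation d V ∧ IsConvex V ∧ typeDegree d V = 3

/-- The set of linear conjugacy classes of homogeneous convex foliations of degree `d` with type of
degree three. -/
def ConjClassesType3 (d : ℕ) : Type :=
  Quotient (conjSetoid.comap (Subtype.val : {V : Triple // IsHomConvexType3 d V} → Triple))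

/-! ## The number `N_d` and the explicit forms -/

/-- The number `N_d` (used for `d ≥ 3`, where the subtraction is not truncated). -/
def numN (d : ℕ) : ℕ :=
  if d % 3 = 1 then (d + 1) / 3 + (∑ l ∈ Finset.Icc 1 (d / 3), (d - 3 * l + 2) / 2)
  else (d + 1) / 3 + (∑ l ∈ Finset.Icc 1 (d / 3), (d - 3 * l + 2) / 2) - 1

/-- The binary monomial `c x^a y^b`. -/
def mon (c : ℂ) (a b : ℕ) : MvPolynomial (Fin 2) ℂ := C c * X 0 ^ a * X 1 ^ b

/-- The common coefficients in `A^d_l` and `B^d_l`. -/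
def coefAB (d l i : ℕ) : ℂ :=
  ((l - 1).choose (i - 1) : ℂ) *
    ∏ j ∈ Finset.Icc 2 i, ((d : ℂ) - 2 * l + j) / ((d : ℂ) - l + j)

/-- The binary form `A^d_l`. -/
def polyA (d l : ℕ) : MvPolynomial (Fin 2) ℂ :=
  -mon 1 (l - 1) (d - l + 1)
    + ∑ i ∈ Finset.Icc 2 l, mon ((-1) ^ i * coefAB d l i) (l - i) (d - l + i)

/-- The binary form `B^d_l`. -/
def polyB (d l : ℕ) : MvPolynomial (Fin 2) ℂ :=
  mon 1 (d - l + 1) (l - 1)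
    + ∑ i ∈ Finset.Icc 2 l, mon ((-1) ^ (i - 1) * coefAB d l i) (d - l + i) (l - i)

/-- The binary form `C^d_{l,ν}`. -/
def polyC (d l ν : ℕ) : MvPolynomial (Fin 2) ℂ :=
  C (∏ j ∈ Finset.Icc l (ν - l + 1), ((d : ℂ) - ν + j) / (j : ℂ)) *
    ∑ i ∈ Finset.range (ν - l + 2),
      mon ((-1) ^ (i + 1) * ((ν - l + 1).choose i : ℂ) *
          ∏ j ∈ Finset.Icc 1 i, ((d : ℂ) - ν + j - 1) / ((d : ℂ) - ν + l + j - 1))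
        (ν - l + 1 - i) (d - ν + l - 1 + i)

/-- The binary form `D^d_{l,ν}`. -/
def polyD (d l ν : ℕ) : MvPolynomial (Fin 2) ℂ :=
  mon 1 (d - l + 1) (l - 1)
    + ∑ i ∈ Finset.Icc 2 l,
        mon ((-1) ^ (i - 1) * ((l - 1).choose (i - 1) : ℂ) *
            ∏ j ∈ Finset.Icc 2 i, ((d : ℂ) - ν + j - 2) / ((d : ℂ) - l + j))
          (d - l + i) (l - i)

/-- The foliation `ω^d_l = A^d_l dx + B^d_l dy`. -/
def omega₁ (d l : ℕ) : Triple := affineForm (polyA d l) (polyB d l)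

/-- The foliation `ω^d_{l,ν} = C^d_{l,ν} dx + D^d_{l,ν} dy`. -/
def omega₂ (d l ν : ℕ) : Triple := affineForm (polyC d l ν) (polyD d l ν)

end ConvexFol

end

noncomputable section

namespace ConvexFol

/-! ## Binary forms -/

/-! A homogeneous foliation `A dx + B dy` is encoded by the rational map `[B : -A]` of degree `d` on
the line at infinity. Up to a constant its inflection divisor is `z (x A + y B) jac A B`
(`inflection_affineForm`): the line at infinity, the lines over the fixed points and the lines over
the critical points. The first two kinds are always invariant, so convexity means that every
critical point is fixed. The radial singularities of order `k` are the fixed points at which `v₀ A +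
v₁ B` vanishes to order `k + 1`, that is, the fixed critical points of multiplicity `k`
(`isRadial_affineForm_iff`). A convex foliation with type of degree three is therefore a map with
exactly three critical points, all fixed, whose multiplicities `k i` add up to `2d - 2` by
Riemann–Hurwitz (`ThreeCritical`, `exists_threeCritical`).

Rigidity: if two such maps share points and multiplicities, then `A B' - A' B` has degree `2d` but
vanishes to order `k i + 1` at the three points, `2d + 1` zeros in all, so the maps coincide
(`proportional_of_fixForm_dvd`). Three points of the line can be moved to `(1,0)`, `(0,1)`, `(1,1)`;
hence the multiplicities determine the conjugacy class (`ThreeCritical.conj`). Conversely, conjugacy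
preserves the numbers of radial singularities (`radialCount_of_conj`).

Existence: divisibility of `C` by a power of `y` and of `D` by a power of `x` is visible on their
monomials. The coefficients of `C + D` are, up to a common factor, the inverse Lagrange denominators
at the exponents of `y`; the resulting divided difference kills polynomials of low degree
(`sum_coef_mul_eval_eq_zero`), which says that `C + D` vanishes to order `ν + 1` at `(1,1)`.

Count: an unordered triple of integers in `[1, d-1]` with sum `2d - 2` is written uniquely as `ν ≤ d
+ l - 2 - ν ≤ d - l`. The first family of forms is the boundary case `ν = 2l - 2`, where the two
largest entries agree. -/

/-- Binary polynomials. -/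
abbrev Binary := MvPolynomial (Fin 2) ℂ

/-- Multiplying by `a` shifts graded components by `i`: the component of `a * b` in degree `i + j`
is `a` times the `j`-th component of `b`, and `a` can be cancelled. -/
theorem isHomogeneous_of_mul_left {σ : Type*} {a b : MvPolynomial σ ℂ} {i j : ℕ}
    (ha : a.IsHomogeneous i) (ha0 : a ≠ 0) (hab : (a * b).IsHomogeneous (i + j)) :
    b.IsHomogeneous j := by
  classical
  let _ : GradedAlgebra (homogeneousSubmodule σ ℂ) := MvPolynomial.gradedAlgebra
  have h1 : homogeneousComponent (i + j) (a * b) = a * homogeneousComponent j b := by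
    rw [← decomposition.decompose'_apply, ← decomposition.decompose'_apply]
    exact DirectSum.coe_decompose_mul_add_of_left_mem (homogeneousSubmodule σ ℂ) (b := b) (j := j)
      ((mem_homogeneousSubmodule i a).2 ha)
  rw [homogeneousComponent_eq_self hab] at h1
  rw [mul_left_cancel₀ ha0 h1]
  exact homogeneousComponent_isHomogeneous j b

/-- The linear form vanishing at `v`. -/
def lineThrough (v : Fin 2 → ℂ) : Binary := C (v 1) * X 0 - C (v 0) * X 1

/-- The determinant of two vectors of the plane. -/
def wedge (v w : Fin 2 → ℂ) : ℂ := v 0 * w 1 - v 1 * w 0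

theorem eval_lineThrough (v w : Fin 2 → ℂ) : eval w (lineThrough v) = - wedge v w := by
  simp [lineThrough, wedge]

theorem wedge_comm (v w : Fin 2 → ℂ) : wedge w v = - wedge v w := by
  simp only [wedge]; ring

theorem wedge_self (v : Fin 2 → ℂ) : wedge v v = 0 := by
  simp only [wedge]; ring

theorem exists_smul_of_wedge_eq_zero {v w : Fin 2 → ℂ} (hv : v ≠ 0) (h : wedge v w = 0) :
    ∃ a : ℂ, w = a • v := by
  simp only [wedge] at h
  by_cases h0 : v 0 = 0
  · have h1 : v 1 ≠ 0 := by
      intro h1; apply hv; funext i; fin_cases i <;> simp [h0, h1]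
    refine ⟨w 1 / v 1, ?_⟩
    have : w 0 = 0 := by
      rw [h0] at h; simpa [h1] using h
    funext i; fin_cases i
    · simp [h0, this]
    · simp; field_simp
  · refine ⟨w 0 / v 0, ?_⟩
    funext i; fin_cases i
    · simp; field_simp
    · simp; field_simp; linear_combination h

theorem isHomogeneous_lineThrough (v : Fin 2 → ℂ) : (lineThrough v).IsHomogeneous 1 :=
  (isHomogeneous_C_mul_X _ _).sub (isHomogeneous_C_mul_X _ _)

theorem lineThrough_ne_zero {v : Fin 2 → ℂ} (hv : v ≠ 0) : lineThrough v ≠ 0 := by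
  intro h
  apply hv
  have h0 := eval_lineThrough v ![1, 0]
  have h1 := eval_lineThrough v ![0, 1]
  rw [h] at h0 h1
  funext i; fin_cases i
  · simpa [wedge] using h1.symm
  · simpa [wedge] using h0.symm

theorem irreducible_of_isHomogeneous_one {σ : Type*} {ℓ : MvPolynomial σ ℂ}
    (h : ℓ.IsHomogeneous 1) (h0 : ℓ ≠ 0) : Irreducible ℓ := by
  refine irreducible_of_totalDegree_eq_one (h.totalDegree h0) ?_
  intro x hx
  obtain ⟨s, hs⟩ := ne_zero_iff.1 h0
  exact (ne_zero_of_dvd_ne_zero hs (hx s)).isUnit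

theorem prime_lineThrough {v : Fin 2 → ℂ} (hv : v ≠ 0) : Prime (lineThrough v) :=
  (irreducible_of_isHomogeneous_one (isHomogeneous_lineThrough v) (lineThrough_ne_zero hv)).prime

/-- Both evaluations become the same algebra map in the quotient by the ideal of `ℓ`. -/
theorem dvd_aeval_sub_aeval {σ R : Type*} [CommRing R] [Algebra ℂ R] {ℓ : R} {f g : σ → R}
    (h : ∀ i, ℓ ∣ f i - g i) (F : MvPolynomial σ ℂ) : ℓ ∣ aeval f F - aeval g F := by
  rw [← Ideal.mem_span_singleton, ← Ideal.Quotient.eq]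
  have : (Ideal.Quotient.mkₐ ℂ (Ideal.span {ℓ})).comp (aeval f) =
      (Ideal.Quotient.mkₐ ℂ (Ideal.span {ℓ})).comp (aeval g) := by
    apply MvPolynomial.algHom_ext
    intro i
    simp only [AlgHom.comp_apply, aeval_X, Ideal.Quotient.mkₐ_eq_mk]
    rw [Ideal.Quotient.eq, Ideal.mem_span_singleton]
    exact h i
  exact DFunLike.congr_fun this F

theorem aeval_mul_of_isHomogeneous {σ R : Type*} [CommRing R] [Algebra ℂ R]
    {F : MvPolynomial σ ℂ} {n : ℕ} (hF : F.IsHomogeneous n) (c : R) (f : σ → R) :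
    aeval (fun i => c * f i) F = c ^ n * aeval f F := by
  rw [aeval_def, aeval_def, eval₂_eq, eval₂_eq, Finset.mul_sum]
  refine Finset.sum_congr rfl fun m hm => ?_
  simp only [mul_pow, Finset.prod_mul_distrib, Finset.prod_pow_eq_pow_sum]
  rw [hF.degree_eq_sum_deg_support hm]
  ring

theorem eval_smul_of_isHomogeneous {σ : Type*} {F : MvPolynomial σ ℂ} {n : ℕ}
    (hF : F.IsHomogeneous n) (c : ℂ) (v : σ → ℂ) : eval (c • v) F = c ^ n * eval v F :=
  aeval_mul_of_isHomogeneous hF c v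

/-- Modulo `lineThrough v` one has `v i * X j ≡ X i * v j`, so homogeneity gives `(v i)^n F ≡ (X
i)^n F(v) = 0`; some `v i` is invertible. -/
theorem lineThrough_dvd_of_eval_eq_zero {F : Binary} {n : ℕ} (hF : F.IsHomogeneous n)
    {v : Fin 2 → ℂ} (hv : v ≠ 0) (h : eval v F = 0) : lineThrough v ∣ F := by
  have key : ∀ i, lineThrough v ∣ C (v i) ^ n * F := by
    intro i
    have h1 := dvd_aeval_sub_aeval (ℓ := lineThrough v)
      (f := fun j => C (v i) * X j) (g := fun j => X i * C (v j)) (by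
        intro j
        fin_cases i <;> fin_cases j
        · exact ⟨0, by simp only [Fin.mk_zero]; ring⟩
        · exact ⟨-1, by simp only [lineThrough, Fin.zero_eta, Fin.mk_one]; ring⟩
        · exact ⟨1, by simp only [lineThrough, Fin.zero_eta, Fin.mk_one]; ring⟩
        · exact ⟨0, by simp only [Fin.mk_one]; ring⟩) F
    rw [aeval_mul_of_isHomogeneous hF, aeval_mul_of_isHomogeneous hF] at h1
    have h2 : aeval (fun j => C (v j) : Fin 2 → Binary) F = C (eval v F) := by
      exact MvPolynomial.aeval_algebraMap_apply (B := Binary) v F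
    rw [h2, h] at h1
    simpa using h1
  obtain ⟨i, hi⟩ := Function.ne_iff.1 hv
  have := key i
  rw [← C_pow] at this
  have hu : IsUnit (C (v i ^ n) : Binary) := (IsUnit.mk0 _ (pow_ne_zero n hi)).map C
  exact (hu.dvd_mul_left).1 this

theorem eval_eq_zero_of_lineThrough_dvd {F : Binary} {v : Fin 2 → ℂ} (h : lineThrough v ∣ F) :
    eval v F = 0 := by
  obtain ⟨G, rfl⟩ := h
  rw [map_mul, eval_lineThrough, wedge_self]; simp

theorem eval_aeval_polynomial {σ : Type*} (f : σ → Polynomial ℂ) (F : MvPolynomial σ ℂ) (s : ℂ) :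
    (aeval f F).eval s = eval (fun i => (f i).eval s) F := by
  have h : (Polynomial.evalRingHom s).comp (aeval f : MvPolynomial σ ℂ →ₐ[ℂ] _).toRingHom =
      eval fun i => (f i).eval s := by
    apply MvPolynomial.ringHom_ext <;> intro i <;> simp
  exact DFunLike.congr_fun h F

/-- If `F(s, 1)` has no root it is a constant `c`; then `F(1, s) = c s^(n+1)` by homogeneity, which
vanishes at `(1, 0)`. -/
theorem exists_zero_of_isHomogeneous {F : Binary} {n : ℕ} (hF : F.IsHomogeneous (n + 1)) :
    ∃ v : Fin 2 → ℂ, v ≠ 0 ∧ eval v F = 0 := by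
  by_contra! hcon
  set p : Polynomial ℂ := aeval ![Polynomial.X, 1] F with hp
  set q : Polynomial ℂ := aeval ![1, Polynomial.X] F with hq
  have evp : ∀ s, p.eval s = eval ![s, 1] F := by
    intro s
    rw [hp, eval_aeval_polynomial]
    congr 2
    funext i; fin_cases i <;> simp
  have evq : ∀ s, q.eval s = eval ![1, s] F := by
    intro s
    rw [hq, eval_aeval_polynomial]
    congr 2
    funext i; fin_cases i <;> simp
  have hdeg : p.degree = 0 := by
    by_contra hd
    obtain ⟨s, hs⟩ := IsAlgClosed.exists_root p hd
    refine hcon ![s, 1] ?_ ?_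
    · intro h; simpa using congrFun h 1
    · rw [← evp]; exact hs
  obtain ⟨c, hc⟩ : ∃ c, p = Polynomial.C c := ⟨_, Polynomial.eq_C_of_degree_eq_zero hdeg⟩
  have hpq : q = Polynomial.C c * Polynomial.X ^ (n + 1) := by
    apply Polynomial.eq_of_infinite_eval_eq
    refine Set.Infinite.mono (s := {0}ᶜ) ?_ (Set.finite_singleton (0 : ℂ)).infinite_compl
    intro s hs
    have hs0 : s ≠ 0 := hs
    change q.eval s = _
    have e1 : (![1, s] : Fin 2 → ℂ) = s • ![s⁻¹, 1] := by
      funext i; fin_cases i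
      · simp [hs0]
      · simp
    rw [evq, e1, eval_smul_of_isHomogeneous hF, ← evp, hc]
    simp only [Polynomial.eval_C, Polynomial.eval_mul, Polynomial.eval_pow, Polynomial.eval_X]
    ring
  refine hcon ![1, 0] ?_ ?_
  · intro h; simpa using congrFun h 0
  · rw [← evq, hpq]; simp

theorem wedge_smul_right (a : ℂ) (v w : Fin 2 → ℂ) : wedge v (a • w) = a * wedge v w := by
  simp [wedge]; ring

theorem wedge_ne_zero_left {v w : Fin 2 → ℂ} (h : wedge v w ≠ 0) : v ≠ 0 := by
  rintro rfl; simp [wedge] at h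

theorem isRelPrime_lineThrough_pow {v w : Fin 2 → ℂ} (h : wedge v w ≠ 0) (m n : ℕ) :
    IsRelPrime (lineThrough v ^ m) (lineThrough w ^ n) := by
  apply IsRelPrime.pow
  rw [(prime_lineThrough (wedge_ne_zero_left h)).irreducible.isRelPrime_iff_not_dvd]
  intro hd
  have := eval_eq_zero_of_lineThrough_dvd hd
  rw [eval_lineThrough, wedge_comm, neg_neg] at this
  exact h this

/-- The product of powers of linear forms vanishing at three points. -/
def triple (p : Fin 3 → Fin 2 → ℂ) (k : Fin 3 → ℕ) : Binary :=
  lineThrough (p 0) ^ k 0 * lineThrough (p 1) ^ k 1 * lineThrough (p 2) ^ k 2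

theorem triple_dvd {p : Fin 3 → Fin 2 → ℂ} (hp : ∀ i j, i ≠ j → wedge (p i) (p j) ≠ 0)
    {k : Fin 3 → ℕ} {F : Binary} (h : ∀ i, lineThrough (p i) ^ k i ∣ F) : triple p k ∣ F := by
  refine IsRelPrime.mul_dvd (IsRelPrime.mul_left ?_ ?_) (IsRelPrime.mul_dvd ?_ (h 0) (h 1)) (h 2)
  all_goals exact isRelPrime_lineThrough_pow (hp _ _ (by decide)) _ _

theorem isHomogeneous_lineThrough_pow (v : Fin 2 → ℂ) (k : ℕ) :
    (lineThrough v ^ k).IsHomogeneous k := by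
  simpa using (isHomogeneous_lineThrough v).pow k

theorem isHomogeneous_triple (p : Fin 3 → Fin 2 → ℂ) (k : Fin 3 → ℕ) :
    (triple p k).IsHomogeneous (∑ i, k i) := by
  rw [Fin.sum_univ_three]
  exact ((isHomogeneous_lineThrough_pow _ _).mul (isHomogeneous_lineThrough_pow _ _)).mul
    (isHomogeneous_lineThrough_pow _ _)

/-- A homogeneous multiple of a nonzero homogeneous form has at least its degree. -/
theorem exists_eq_mul_of_dvd {σ : Type*} {F G : MvPolynomial σ ℂ} {m n : ℕ}
    (hG : G.IsHomogeneous m) (hF : F.IsHomogeneous n) (hF0 : F ≠ 0) (h : G ∣ F) :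
    ∃ j E, n = m + j ∧ E.IsHomogeneous j ∧ E ≠ 0 ∧ F = G * E := by
  obtain ⟨E, rfl⟩ := h
  have hG0 := left_ne_zero_of_mul hF0
  have hE0 := right_ne_zero_of_mul hF0
  have hd := totalDegree_mul_of_isDomain hG0 hE0
  rw [hF.totalDegree hF0, hG.totalDegree hG0] at hd
  exact ⟨_, E, hd, isHomogeneous_of_mul_left hG hG0 (hd ▸ hF), hE0, rfl⟩

theorem eq_zero_of_dvd_of_lt {σ : Type*} {F G : MvPolynomial σ ℂ} {m n : ℕ}
    (hG : G.IsHomogeneous m) (hF : F.IsHomogeneous n) (h : G ∣ F) (hnm : n < m) : F = 0 := by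
  by_contra hF0
  obtain ⟨j, E, hj, -⟩ := exists_eq_mul_of_dvd hG hF hF0 h
  omega

theorem exists_C_mul_of_dvd {σ : Type*} {F G : MvPolynomial σ ℂ} {n : ℕ}
    (hG : G.IsHomogeneous n) (hF : F.IsHomogeneous n) (hF0 : F ≠ 0) (h : G ∣ F) :
    ∃ c : ℂ, c ≠ 0 ∧ F = C c * G := by
  obtain ⟨j, E, hj, hE, hE0, rfl⟩ := exists_eq_mul_of_dvd hG hF hF0 h
  obtain rfl : j = 0 := by omega
  rw [← totalDegree_zero_iff_isHomogeneous, totalDegree_eq_zero_iff_eq_C] at hE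
  refine ⟨coeff 0 E, ?_, ?_⟩
  · intro h0; rw [h0, C_0] at hE; exact hE0 hE
  · rw [← hE, mul_comm]

/-! ### Orders of vanishing read along lines -/

/-- Parametrization of a line by a one-variable polynomial. -/
def along {n : ℕ} (v w : Fin n → ℂ) : MvPolynomial (Fin n) ℂ →ₐ[ℂ] Polynomial ℂ :=
  aeval fun k => Polynomial.C (v k) + Polynomial.C (w k) * Polynomial.X

theorem along_lineThrough (v w : Fin 2 → ℂ) :
    along v w (lineThrough v) = Polynomial.C (- wedge v w) * Polynomial.X := by
  simp only [along, lineThrough, map_sub, map_mul, aeval_X, ← algebraMap_eq, AlgHom.commutes,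
    wedge, map_neg, Polynomial.algebraMap_eq]
  ring

theorem eval_zero_along {n : ℕ} (v w : Fin n → ℂ) (F : MvPolynomial (Fin n) ℂ) :
    (along v w F).eval 0 = eval v F := by
  rw [along, eval_aeval_polynomial]
  simp

theorem X_pow_dvd_along_of_dvd {F : Binary} {n : ℕ} {v : Fin 2 → ℂ} (w : Fin 2 → ℂ)
    (h : lineThrough v ^ n ∣ F) : Polynomial.X ^ n ∣ along v w F := by
  obtain ⟨G, rfl⟩ := h
  rw [map_mul, map_pow, along_lineThrough, mul_pow, mul_assoc]
  exact Dvd.dvd.mul_left (Dvd.intro _ rfl) _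

/-- The order of vanishing of a binary form at a point can be read off along a transverse line. -/
theorem lineThrough_pow_dvd_iff {v w : Fin 2 → ℂ} (h : wedge v w ≠ 0) (n : ℕ) {F : Binary}
    {m : ℕ} (hF : F.IsHomogeneous m) :
    lineThrough v ^ n ∣ F ↔ Polynomial.X ^ n ∣ along v w F := by
  refine ⟨X_pow_dvd_along_of_dvd w, ?_⟩
  have hv := wedge_ne_zero_left h
  induction n generalizing F m with
  | zero => simp
  | succ n ih =>
    intro hd
    by_cases hF0 : F = 0
    · simp [hF0]
    have h0 : eval v F = 0 := by
      rw [← eval_zero_along v w]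
      obtain ⟨q, hq⟩ := hd
      rw [hq]; simp
    obtain ⟨j, E, hj, hE, hE0, rfl⟩ := exists_eq_mul_of_dvd (isHomogeneous_lineThrough v) hF hF0
      (lineThrough_dvd_of_eval_eq_zero hF hv h0)
    rw [pow_succ']
    refine mul_dvd_mul_left _ (ih hE ?_)
    -- Along a transverse line, `lineThrough v` is a nonzero constant times the parameter, so one
    -- linear factor costs exactly one power of it.
    rw [map_mul, along_lineThrough, pow_succ', mul_assoc] at hd
    have hu : IsUnit (Polynomial.C (-wedge v w)) :=
      Polynomial.isUnit_C.2 (IsUnit.mk0 _ (neg_ne_zero.2 h))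
    rw [hu.dvd_mul_left] at hd
    exact (mul_dvd_mul_iff_left Polynomial.X_ne_zero).1 hd

/-! ## Jacobians and fixed points of pairs of binary forms -/

/-- A binary form splits into linear factors, so a prime dividing its image divides the image of one
of them. The homomorphism `φ` is arbitrary because the result serves both in two variables and after
the embedding into three. -/
theorem exists_lineThrough_of_prime_dvd {S : Type*} [CommRing S] [IsDomain S] (φ : Binary →+* S)
    {z : S} (hz : Prime z) {n : ℕ} {F : Binary} (hF : F.IsHomogeneous n) (hF0 : F ≠ 0)
    (h : z ∣ φ F) : ∃ v : Fin 2 → ℂ, v ≠ 0 ∧ eval v F = 0 ∧ z ∣ φ (lineThrough v) := by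
  induction n generalizing F with
  | zero =>
    rw [← totalDegree_zero_iff_isHomogeneous, totalDegree_eq_zero_iff_eq_C] at hF
    rw [hF] at h hF0
    have hc : coeff 0 F ≠ 0 := by
      intro h0; rw [h0, C_0] at hF0; exact hF0 rfl
    have hu : IsUnit (φ (C (coeff 0 F))) := ((IsUnit.mk0 _ hc).map C).map φ
    exact absurd (isUnit_of_dvd_unit h hu) hz.not_isUnit
  | succ n ih =>
    obtain ⟨v, hv, hv0⟩ := exists_zero_of_isHomogeneous hF
    obtain ⟨j, E, hj, hE, hE0, rfl⟩ := exists_eq_mul_of_dvd (isHomogeneous_lineThrough v) hF hF0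
      (lineThrough_dvd_of_eval_eq_zero hF hv hv0)
    obtain rfl : j = n := by omega
    rw [map_mul] at h
    rcases hz.dvd_or_dvd h with h | h
    · exact ⟨v, hv, hv0, h⟩
    · obtain ⟨u, hu, hu0, hzu⟩ := ih hE hE0 h
      exact ⟨u, hu, by rw [map_mul, hu0, mul_zero], hzu⟩

theorem eval_eq_zero_of_wedge_eq_zero {F : Binary} {n : ℕ} (hF : F.IsHomogeneous n)
    {v w : Fin 2 → ℂ} (hv : v ≠ 0) (h : wedge v w = 0) (h0 : eval v F = 0) :
    eval w F = 0 := by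
  obtain ⟨a, rfl⟩ := exists_smul_of_wedge_eq_zero hv h
  rw [eval_smul_of_isHomogeneous hF, h0, mul_zero]

theorem isRelPrime_of_no_common_zero {A B : Binary} {n : ℕ} (hA : A.IsHomogeneous n)
    (hA0 : A ≠ 0)
    (h : ∀ v : Fin 2 → ℂ, v ≠ 0 → eval v A = 0 → eval v B ≠ 0) : IsRelPrime A B := by
  refine WfDvdMonoid.isRelPrime_of_no_irreducible_factors (fun h => hA0 h.1) ?_
  intro z hz hzA hzB
  obtain ⟨v, hv, hv0, hzv⟩ := exists_lineThrough_of_prime_dvd (RingHom.id _) hz.prime hA hA0 hzA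
  have hass : Associated z (lineThrough v) :=
    hz.associated_of_dvd (prime_lineThrough hv).irreducible hzv
  exact h v hv hv0 (eval_eq_zero_of_lineThrough_dvd (hass.dvd_iff_dvd_left.1 hzB))

theorem no_common_zero_of_isRelPrime {A B : Binary} {m n : ℕ} (hA : A.IsHomogeneous m)
    (hB : B.IsHomogeneous n) (h : IsRelPrime A B) {v : Fin 2 → ℂ} (hv : v ≠ 0)
    (hvA : eval v A = 0) : eval v B ≠ 0 := fun hvB =>
  (prime_lineThrough hv).not_isUnit
    (h (lineThrough_dvd_of_eval_eq_zero hA hv hvA) (lineThrough_dvd_of_eval_eq_zero hB hv hvB))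

/-- The Jacobian determinant of two binary polynomials. -/
def jac (F G : Binary) : Binary := pderiv 0 F * pderiv 1 G - pderiv 1 F * pderiv 0 G

/-- The form `v₀ A + v₁ B`; it vanishes at `v` iff `[v]` is fixed by the map `[B : -A]`. -/
def fixForm (A B : Binary) (v : Fin 2 → ℂ) : Binary := C (v 0) * A + C (v 1) * B

/-- `v₀ A + v₁ B` has order exactly `k + 1` at `v`. -/
def HasOrder (A B : Binary) (v : Fin 2 → ℂ) (k : ℕ) : Prop :=
  lineThrough v ^ (k + 1) ∣ fixForm A B v ∧ ¬ lineThrough v ^ (k + 2) ∣ fixForm A B v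

theorem isHomogeneous_jac {A B : Binary} {d : ℕ} (hA : A.IsHomogeneous d) (hB : B.IsHomogeneous d) :
    (jac A B).IsHomogeneous (d - 1 + (d - 1)) :=
  (hA.pderiv.mul hB.pderiv).sub (hA.pderiv.mul hB.pderiv)

theorem isHomogeneous_fixForm {A B : Binary} {d : ℕ} (hA : A.IsHomogeneous d)
    (hB : B.IsHomogeneous d) (v : Fin 2 → ℂ) : (fixForm A B v).IsHomogeneous d :=
  (hA.C_mul _).add (hB.C_mul _)

/-- Once `ℓ ^ k` is factored out, only the term with `jac ℓ G` survives modulo `ℓ`; the multiplicity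
of a critical point is read from it. -/
theorem jac_pow_mul (ℓ H G : Binary) (k : ℕ) : jac (ℓ ^ (k + 1) * H) G =
    ℓ ^ k * (C ((k : ℂ) + 1) * H * jac ℓ G + ℓ * jac H G) := by
  simp only [jac, Derivation.leibniz, Derivation.leibniz_pow, smul_eq_mul, nsmul_eq_mul,
    Nat.add_sub_cancel, map_add, map_natCast, map_one]
  push_cast
  ring

/-- At `v` this Jacobian is `v₀ ∂₀G + v₁ ∂₁G`, which Euler's identity evaluates. -/
theorem eval_jac_lineThrough {G : Binary} {d : ℕ} (hG : G.IsHomogeneous d) (v : Fin 2 → ℂ) :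
    eval v (jac (lineThrough v) G) = d * eval v G := by
  have h := congrArg (eval v) hG.sum_X_mul_pderiv
  simp only [Fin.sum_univ_two, map_add, map_mul, eval_X, nsmul_eq_mul, map_natCast] at h
  rw [← h]
  simp [jac, lineThrough, pderiv_X]
  ring

/-- A change of basis in the pencil spanned by `A` and `B` multiplies the Jacobian by its
determinant. With `w` transverse to `v`, the order of `jac A B` at `v` can thus be computed from
`fixForm A B v` itself. -/
theorem jac_fixForm (A B : Binary) (v w : Fin 2 → ℂ) :
    jac (fixForm A B v) (fixForm A B w) = C (wedge v w) * jac A B := by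
  simp only [jac, fixForm, map_add, pderiv_C_mul, wedge, C_sub, C_mul]
  ring

theorem exists_wedge_ne_zero {v : Fin 2 → ℂ} (hv : v ≠ 0) : ∃ w, wedge v w ≠ 0 := by
  by_contra! h
  apply hv
  have h0 := h ![0, 1]
  have h1 := h ![1, 0]
  funext i; fin_cases i
  · simpa [wedge] using h0
  · simpa [wedge] using h1

theorem isUnit_C_of_ne_zero {σ : Type*} {c : ℂ} (hc : c ≠ 0) : IsUnit (C c : MvPolynomial σ ℂ) :=
  (IsUnit.mk0 _ hc).map C

theorem lineThrough_pow_dvd_jac {A B : Binary} {v : Fin 2 → ℂ} (hv : v ≠ 0) {k : ℕ}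
    (h : lineThrough v ^ (k + 1) ∣ fixForm A B v) : lineThrough v ^ k ∣ jac A B := by
  obtain ⟨w, hw⟩ := exists_wedge_ne_zero hv
  obtain ⟨H, hH⟩ := h
  rw [← (isUnit_C_of_ne_zero hw).dvd_mul_left, ← jac_fixForm, hH, jac_pow_mul]
  exact Dvd.intro _ rfl

/-- With `fixForm A B v = ℓ^(k+1) H`, the cofactor of `ℓ^k` in the Jacobian takes at `v` the value
`(k+1) H(v) · d · G(v)`, where `G = fixForm A B w`. Here `H(v) ≠ 0` by exactness of the order, and
`G(v) ≠ 0` since otherwise `A` and `B` would both vanish at `v`. -/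
theorem not_lineThrough_pow_succ_dvd_jac {A B : Binary} {d : ℕ} (hd : d ≠ 0)
    (hA : A.IsHomogeneous d) (hB : B.IsHomogeneous d) {v : Fin 2 → ℂ} (hv : v ≠ 0)
    (h0 : eval v A = 0 → eval v B ≠ 0) {k : ℕ} (h : HasOrder A B v k) :
    ¬ lineThrough v ^ (k + 1) ∣ jac A B := by
  intro hdvd
  obtain ⟨w, hw⟩ := exists_wedge_ne_zero hv
  obtain ⟨⟨H, hH⟩, hn⟩ := h
  rw [← (isUnit_C_of_ne_zero hw).dvd_mul_left, ← jac_fixForm, hH, jac_pow_mul, pow_succ] at hdvd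
  have hℓ := prime_lineThrough hv
  replace hdvd := (mul_dvd_mul_iff_left (pow_ne_zero k hℓ.ne_zero)).1 hdvd
  rw [dvd_add_left (Dvd.intro _ rfl)] at hdvd
  rcases hℓ.dvd_or_dvd hdvd with h1 | h1
  · have hk : (k : ℂ) + 1 ≠ 0 := by exact_mod_cast Nat.succ_ne_zero k
    rw [(isUnit_C_of_ne_zero hk).dvd_mul_left] at h1
    apply hn
    rw [hH, pow_succ]
    exact mul_dvd_mul_left _ h1
  · have h2 := eval_eq_zero_of_lineThrough_dvd h1
    rw [eval_jac_lineThrough (isHomogeneous_fixForm hA hB w)] at h2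
    have h3 : eval v (fixForm A B w) = 0 := by
      simpa [hd] using h2
    have h4 : eval v (fixForm A B v) = 0 :=
      eval_eq_zero_of_lineThrough_dvd (hH ▸ (dvd_mul_of_dvd_left (dvd_pow_self _ (by omega)) _))
    simp only [fixForm, map_add, map_mul, eval_C] at h3 h4
    have hA0 : wedge v w * eval v A = 0 := by
      simp only [wedge]; linear_combination w 1 * h4 - v 1 * h3
    have hB0 : wedge v w * eval v B = 0 := by
      simp only [wedge]; linear_combination v 0 * h3 - w 0 * h4
    exact h0 (by simpa [hw] using hA0) (by simpa [hw] using hB0)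

theorem exists_hasOrder {A B : Binary} {d : ℕ} (hA : A.IsHomogeneous d) (hB : B.IsHomogeneous d)
    {v : Fin 2 → ℂ} (hv : v ≠ 0) (hF : fixForm A B v ≠ 0) (h : eval v (fixForm A B v) = 0) :
    ∃ k, HasOrder A B v k := by
  have hfin : FiniteMultiplicity (lineThrough v) (fixForm A B v) :=
    FiniteMultiplicity.of_prime_left (prime_lineThrough hv) hF
  have h1 : lineThrough v ∣ fixForm A B v :=
    lineThrough_dvd_of_eval_eq_zero (isHomogeneous_fixForm hA hB v) hv h
  have hpos : multiplicity (lineThrough v) (fixForm A B v) ≠ 0 := by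
    intro h2
    exact hfin.multiplicity_lt_iff_not_dvd (k := 1).1 (by omega) (by simpa using h1)
  obtain ⟨k, hk⟩ := Nat.exists_eq_succ_of_ne_zero hpos
  refine ⟨k, ?_, ?_⟩
  · rw [← Nat.succ_eq_add_one, ← hk]; exact pow_multiplicity_dvd _ _
  · exact hfin.not_pow_dvd_of_multiplicity_lt (by omega)

/-- At a fixed point the order of the Jacobian is known and finite, so one fixed point suffices. -/
theorem jac_ne_zero {A B : Binary} {d : ℕ} (hd : d ≠ 0)
    (hA : A.IsHomogeneous d) (hB : B.IsHomogeneous d) {v : Fin 2 → ℂ} (hv : v ≠ 0)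
    (h0 : eval v A = 0 → eval v B ≠ 0) (hF : fixForm A B v ≠ 0)
    (h : eval v (fixForm A B v) = 0) : jac A B ≠ 0 := by
  obtain ⟨k, hk⟩ := exists_hasOrder hA hB hv hF h
  intro hj
  exact not_lineThrough_pow_succ_dvd_jac hd hA hB hv h0 hk (hj ▸ dvd_zero _)

/-! ### Maps with three fixed critical points -/

/-- The map `[B : -A]` of degree `d` has exactly the three critical points `p i`, all of them
fixed, with multiplicities `k i`. -/
structure ThreeCritical (d : ℕ) (A B : Binary) (p : Fin 3 → Fin 2 → ℂ) (k : Fin 3 → ℕ) : Prop where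
  homA : A.IsHomogeneous d
  homB : B.IsHomogeneous d
  relPrime : IsRelPrime A B
  indep : ∀ i j, i ≠ j → wedge (p i) (p j) ≠ 0
  order : ∀ i, HasOrder A B (p i) (k i)
  pos : ∀ i, 1 ≤ k i
  -- Riemann–Hurwitz: `jac A B` has degree `2d - 2`.
  sum : ∑ i, k i + 2 = 2 * d
  root : ∀ u : Fin 2 → ℂ, u ≠ 0 → eval u (jac A B) = 0 → ∃ i, wedge (p i) u = 0

theorem ne_zero_of_indep {p : Fin 3 → Fin 2 → ℂ} (hp : ∀ i j, i ≠ j → wedge (p i) (p j) ≠ 0)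
    (i : Fin 3) : p i ≠ 0 :=
  wedge_ne_zero_left (hp i (i + 1) (by fin_cases i <;> decide))

/-- `A B' - A' B` is a combination of `fixForm A B (p i)` and `fixForm A' B' (p i)`, hence vanishes
to order `k i + 1` at each `p i`. The total `∑ k i + 3` exceeds its degree `2d`, so it is zero, and
coprimality gives proportionality. -/
theorem proportional_of_fixForm_dvd {A B A' B' : Binary} {d : ℕ} (hd : d ≠ 0)
    (hA : A.IsHomogeneous d) (hB : B.IsHomogeneous d) (hAB : IsRelPrime A B)
    (hA' : A'.IsHomogeneous d) (hB' : B'.IsHomogeneous d) (hAB' : IsRelPrime A' B')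
    {p : Fin 3 → Fin 2 → ℂ} (hp : ∀ i j, i ≠ j → wedge (p i) (p j) ≠ 0) {k : Fin 3 → ℕ}
    (h : ∀ i, lineThrough (p i) ^ (k i + 1) ∣ fixForm A B (p i))
    (h' : ∀ i, lineThrough (p i) ^ (k i + 1) ∣ fixForm A' B' (p i)) (hk : 2 * d ≤ ∑ i, k i + 2) :
    ∃ c : ℂ, c ≠ 0 ∧ A' = C c * A ∧ B' = C c * B := by
  have hdvd : ∀ i, lineThrough (p i) ^ (k i + 1) ∣ A * B' - A' * B := by
    intro i
    have e0 : C (p i 0) * (A * B' - A' * B) =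
        fixForm A B (p i) * B' - fixForm A' B' (p i) * B := by
      simp only [fixForm]; ring
    have e1 : C (p i 1) * (A * B' - A' * B) =
        fixForm A' B' (p i) * A - fixForm A B (p i) * A' := by
      simp only [fixForm]; ring
    by_cases h0 : p i 0 = 0
    · have h1 : p i 1 ≠ 0 := by
        intro h1
        apply ne_zero_of_indep hp i
        funext j; fin_cases j <;> simp [h0, h1]
      rw [← (isUnit_C_of_ne_zero h1).dvd_mul_left, e1]
      exact dvd_sub (Dvd.dvd.mul_right (h' i) _) (Dvd.dvd.mul_right (h i) _)
    · rw [← (isUnit_C_of_ne_zero h0).dvd_mul_left, e0]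
      exact dvd_sub (Dvd.dvd.mul_right (h i) _) (Dvd.dvd.mul_right (h' i) _)
  have hzero : A * B' - A' * B = 0 := by
    refine eq_zero_of_dvd_of_lt (isHomogeneous_triple p fun i => k i + 1)
      ((hA.mul hB').sub (hA'.mul hB)) (triple_dvd hp hdvd) ?_
    rw [Fin.sum_univ_three] at hk ⊢
    omega
  rw [sub_eq_zero] at hzero
  -- The zero form is not coprime to `Q`, since `Q` has positive degree and hence a linear factor.
  have nz : ∀ {P Q : Binary}, Q.IsHomogeneous d → IsRelPrime P Q → P ≠ 0 := by
    rintro P Q hQ hPQ rfl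
    obtain ⟨e, rfl⟩ := Nat.exists_eq_succ_of_ne_zero hd
    obtain ⟨v, hv, hv0⟩ := exists_zero_of_isHomogeneous hQ
    exact (prime_lineThrough hv).not_isUnit
      (hPQ (dvd_zero _) (lineThrough_dvd_of_eval_eq_zero hQ hv hv0))
  have hA0 := nz hB hAB
  have hA0' := nz hB' hAB'
  have hd1 : A ∣ A' := hAB.dvd_of_dvd_mul_right (hzero ▸ Dvd.intro _ rfl)
  obtain ⟨c, hc, rfl⟩ := exists_C_mul_of_dvd hA hA' hA0' hd1
  refine ⟨c, hc, rfl, mul_left_cancel₀ hA0 ?_⟩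
  rw [hzero]; ring

theorem pow_dvd_of_pow_succ_dvd_mul {ℓ m F : Binary} (hℓ : Prime ℓ) (hm : Irreducible m) {k : ℕ}
    (h : ℓ ^ (k + 1) ∣ m * F) : ℓ ^ k ∣ F := by
  by_cases hlm : ℓ ∣ m
  · have := hℓ.irreducible.associated_of_dvd hm hlm
    obtain ⟨u, rfl⟩ := this
    rw [pow_succ', mul_assoc] at h
    have h2 := (mul_dvd_mul_iff_left hℓ.ne_zero).1 h
    rwa [u.isUnit.dvd_mul_left] at h2
  · exact (pow_dvd_pow _ (by omega)).trans (hℓ.pow_dvd_of_dvd_mul_left _ hlm h)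

theorem fixForm_mul (ℓ A B : Binary) (v : Fin 2 → ℂ) :
    fixForm (ℓ * A) (ℓ * B) v = ℓ * fixForm A B v := by
  simp only [fixForm]; ring

theorem triple_dvd_jac {A B : Binary} {p : Fin 3 → Fin 2 → ℂ}
    (hp : ∀ i j, i ≠ j → wedge (p i) (p j) ≠ 0) {k : Fin 3 → ℕ}
    (h : ∀ i, lineThrough (p i) ^ (k i + 1) ∣ fixForm A B (p i)) : triple p k ∣ jac A B :=
  triple_dvd hp fun i => lineThrough_pow_dvd_jac (ne_zero_of_indep hp i) (h i)

/-- The criterion used on explicit forms: divisibility at three points with the right total gives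
everything else by comparing with the degree `2d - 2` of the Jacobian. The two conditions at `p 0`
only serve to make the Jacobian nonzero. -/
theorem threeCritical_of_dvd {d : ℕ} {A B : Binary} (hA : A.IsHomogeneous d)
    (hB : B.IsHomogeneous d) {p : Fin 3 → Fin 2 → ℂ}
    (hp : ∀ i j, i ≠ j → wedge (p i) (p j) ≠ 0) {k : Fin 3 → ℕ} (hk : ∀ i, 1 ≤ k i)
    (hsum : ∑ i, k i + 2 = 2 * d)
    (h : ∀ i, lineThrough (p i) ^ (k i + 1) ∣ fixForm A B (p i))
    (h0 : eval (p 0) A = 0 → eval (p 0) B ≠ 0) (hF : fixForm A B (p 0) ≠ 0) :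
    ThreeCritical d A B p k := by
  have hne := ne_zero_of_indep hp
  have hsum' := hsum
  rw [Fin.sum_univ_three] at hsum'
  have k0 := hk 0
  have k1 := hk 1
  have k2 := hk 2
  have hev : ∀ {P Q : Binary} {n : ℕ}, lineThrough (p 0) ^ (n + 1) ∣ fixForm P Q (p 0) →
      eval (p 0) (fixForm P Q (p 0)) = 0 := fun h =>
    eval_eq_zero_of_lineThrough_dvd ((dvd_pow_self _ (by omega)).trans h)
  have hJ : jac A B ≠ 0 := jac_ne_zero (by omega) hA hB (hne 0) h0 hF (hev (h 0))
  have hJhom := isHomogeneous_jac hA hB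
  refine ⟨hA, hB, ?_, hp, ?_, hk, hsum, ?_⟩
  · have hAB0 : A ≠ 0 ∨ B ≠ 0 := by
      by_contra! hcon
      exact hF (by simp [fixForm, hcon.1, hcon.2])
    have nocommon : ∀ v : Fin 2 → ℂ, v ≠ 0 → eval v A = 0 → eval v B ≠ 0 := by
      intro v hv hvA hvB
      obtain ⟨A₁, rfl⟩ := lineThrough_dvd_of_eval_eq_zero hA hv hvA
      obtain ⟨B₁, rfl⟩ := lineThrough_dvd_of_eval_eq_zero hB hv hvB
      obtain ⟨e, rfl⟩ : ∃ e, d = 1 + e := ⟨d - 1, by omega⟩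
      have hA₁ := isHomogeneous_of_mul_left (isHomogeneous_lineThrough v)
        (lineThrough_ne_zero hv) hA
      have hB₁ := isHomogeneous_of_mul_left (isHomogeneous_lineThrough v)
        (lineThrough_ne_zero hv) hB
      have hpv := prime_lineThrough hv
      simp only [fixForm_mul] at h hF
      have hv0 : eval (p 0) (lineThrough v) ≠ 0 := by
        intro hz
        exact h0 (by rw [map_mul, hz, zero_mul]) (by rw [map_mul, hz, zero_mul])
      have strong : ∀ i, eval (p i) (lineThrough v) ≠ 0 →
          lineThrough (p i) ^ (k i + 1) ∣ fixForm A₁ B₁ (p i) := fun i hi =>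
        (prime_lineThrough (hne i)).pow_dvd_of_dvd_mul_left _
          (fun hd => hi (eval_eq_zero_of_lineThrough_dvd hd)) (h i)
      have weak : ∀ i, lineThrough (p i) ^ (k i - 1 + 1) ∣ fixForm A₁ B₁ (p i) := by
        intro i
        rw [Nat.sub_add_cancel (hk i)]
        exact pow_dvd_of_pow_succ_dvd_mul (prime_lineThrough (hne i)) hpv.irreducible (h i)
      have hJ₁ : jac A₁ B₁ ≠ 0 := by
        refine jac_ne_zero (by omega) hA₁ hB₁ (hne 0) ?_ (right_ne_zero_of_mul hF)
          (hev (strong 0 hv0))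
        intro hz hz'
        exact h0 (by rw [map_mul, hz, mul_zero]) (by rw [map_mul, hz', mul_zero])
      have hJhom₁ := isHomogeneous_jac hA₁ hB₁
      -- Cancelling a common linear factor lowers the degree of the Jacobian by two, but the total
      -- multiplicity by at most one.
      have concl : ∀ k' : Fin 3 → ℕ, k' 0 + k' 1 + k' 2 + 1 = k 0 + k 1 + k 2 →
          (∀ i, lineThrough (p i) ^ (k' i + 1) ∣ fixForm A₁ B₁ (p i)) → False := by
        intro k' hk' hdv
        refine hJ₁ (eq_zero_of_dvd_of_lt (isHomogeneous_triple p k') hJhom₁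
          (triple_dvd_jac hp hdv) ?_)
        rw [Fin.sum_univ_three]
        omega
      -- The common zero `v` is not `p 0`, and it coincides projectively with at most one of `p 1`,
      -- `p 2`; only there can a power be lost.
      by_cases h1 : eval (p 1) (lineThrough v) = 0
      · refine concl ![k 0, k 1 - 1, k 2] (by simp; omega) ?_
        intro i; fin_cases i
        · exact strong 0 hv0
        · exact weak 1
        · refine strong 2 ?_
          intro h2
          rw [eval_lineThrough, neg_eq_zero] at h1 h2
          obtain ⟨a, ha⟩ := exists_smul_of_wedge_eq_zero hv h1
          obtain ⟨b, hb⟩ := exists_smul_of_wedge_eq_zero hv h2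
          apply hp 1 2 (by decide)
          rw [ha, hb, wedge_smul_right, wedge_comm, wedge_smul_right, wedge_self]
          simp
      · refine concl ![k 0, k 1, k 2 - 1] (by simp; omega) ?_
        intro i; fin_cases i
        · exact strong 0 hv0
        · exact strong 1 h1
        · exact weak 2
    rcases hAB0 with hA0 | hB0
    · exact isRelPrime_of_no_common_zero hA hA0 nocommon
    · exact (isRelPrime_of_no_common_zero hB hB0 fun v hv hb ha => nocommon v hv ha hb).symm
  · intro i
    refine ⟨h i, fun hdv => hJ ?_⟩
    -- One more power at `p i` would make the divisor of the Jacobian too large.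
    refine eq_zero_of_dvd_of_lt (isHomogeneous_triple p (Function.update k i (k i + 1))) hJhom
      (triple_dvd_jac hp ?_) ?_
    · intro j
      by_cases hj : j = i
      · subst hj; simpa using hdv
      · simpa [hj] using h j
    · rw [Fin.sum_univ_three]
      fin_cases i <;> simp <;> omega
  · intro u hu hu0
    have ht := triple_dvd_jac hp h
    have h2 : (∑ i, k i) = d - 1 + (d - 1) := by omega
    obtain ⟨c, hc, hcJ⟩ := exists_C_mul_of_dvd (h2 ▸ isHomogeneous_triple p k) hJhom hJ ht
    rw [hcJ] at hu0
    simp only [triple, map_mul, eval_C, map_pow, eval_lineThrough, mul_eq_zero, hc, false_or] at hu0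
    rcases hu0 with (h3 | h3) | h3
    · exact ⟨0, neg_eq_zero.1 (eq_zero_of_pow_eq_zero h3)⟩
    · exact ⟨1, neg_eq_zero.1 (eq_zero_of_pow_eq_zero h3)⟩
    · exact ⟨2, neg_eq_zero.1 (eq_zero_of_pow_eq_zero h3)⟩

/-- The total multiplicity is forced: the quotient of the Jacobian by its known factors has degree
zero, because a zero of it would be some `p i` and would raise the exact order there. -/
theorem threeCritical_of_hasOrder {d : ℕ} (hd : d ≠ 0) {A B : Binary} (hA : A.IsHomogeneous d)
    (hB : B.IsHomogeneous d) (hAB : IsRelPrime A B) {p : Fin 3 → Fin 2 → ℂ}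
    (hp : ∀ i j, i ≠ j → wedge (p i) (p j) ≠ 0) {k : Fin 3 → ℕ} (hk : ∀ i, 1 ≤ k i)
    (h : ∀ i, HasOrder A B (p i) (k i))
    (hroot : ∀ u : Fin 2 → ℂ, u ≠ 0 → eval u (jac A B) = 0 → ∃ i, wedge (p i) u = 0) :
    ThreeCritical d A B p k := by
  refine ⟨hA, hB, hAB, hp, h, hk, ?_, hroot⟩
  have hne := ne_zero_of_indep hp
  have hexact : ∀ i, ¬ lineThrough (p i) ^ (k i + 1) ∣ jac A B := fun i =>
    not_lineThrough_pow_succ_dvd_jac hd hA hB (hne i)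
      (no_common_zero_of_isRelPrime hA hB hAB (hne i)) (h i)
  have hJ : jac A B ≠ 0 := fun h0 => hexact 0 (h0 ▸ dvd_zero _)
  obtain ⟨j, E, hj, hE, hE0, hJE⟩ := exists_eq_mul_of_dvd (isHomogeneous_triple p k)
    (isHomogeneous_jac hA hB) hJ (triple_dvd_jac hp fun i => (h i).1)
  cases j with
  | zero => omega
  | succ j =>
    exfalso
    obtain ⟨u, hu, hu0⟩ := exists_zero_of_isHomogeneous hE
    obtain ⟨i, hi⟩ := hroot u hu (by rw [hJE, map_mul, hu0, mul_zero])
    apply hexact i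
    have h1 : lineThrough (p i) ∣ E := by
      refine lineThrough_dvd_of_eval_eq_zero hE (hne i) ?_
      rw [wedge_comm, neg_eq_zero] at hi
      exact eval_eq_zero_of_wedge_eq_zero hE hu hi hu0
    rw [hJE, pow_succ]
    refine mul_dvd_mul ?_ h1
    fin_cases i
    · exact Dvd.dvd.mul_right (Dvd.dvd.mul_right dvd_rfl _) _
    · exact Dvd.dvd.mul_right (Dvd.dvd.mul_left dvd_rfl _) _
    · exact Dvd.dvd.mul_left dvd_rfl _

/-! ## The explicit forms -/

-- Among the nodes `0, …, e + r`, those below `e` contribute `e!` and those above contribute `(-1)^r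
-- r!`. With the next two products this makes the Lagrange denominators explicit.
open scoped Nat in
theorem prod_erase_sub (e r : ℕ) : ∏ j ∈ (Finset.range (e + 1 + r)).erase e, ((e : ℂ) - j) =
    (-1) ^ r * e ! * r ! := by
  induction r with
  | zero =>
    have : (Finset.range (e + 1 + 0)).erase e = Finset.range e := by
      ext; simp; omega
    rw [this, ← Finset.prod_range_reflect]
    have h : ∀ j ∈ Finset.range e, (e : ℂ) - ((e - 1 - j : ℕ) : ℂ) = ((j + 1 : ℕ) : ℂ) := by
      intro j hj
      rw [Finset.mem_range] at hj
      rw [← Nat.cast_sub (by omega)]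
      congr 1; omega
    rw [Finset.prod_congr rfl h, ← Nat.cast_prod, Finset.prod_range_add_one_eq_factorial]
    simp
  | succ r ih =>
    have : (Finset.range (e + 1 + (r + 1))).erase e =
        insert (e + 1 + r) ((Finset.range (e + 1 + r)).erase e) := by
      ext; simp; omega
    rw [this, Finset.prod_insert (by simp), ih, Nat.factorial_succ]
    push_cast; ring

open scoped Nat in
theorem prod_range_sub_of_lt (e r m : ℕ) :
    (∏ j ∈ Finset.range (m + 1), ((e : ℂ) - ((e + r + 1 : ℕ) + j))) * r ! =
    (-1) ^ (m + 1) * (r + m + 1)! := by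
  induction m with
  | zero => simp [Nat.factorial_succ]; ring
  | succ m ih =>
    rw [Finset.prod_range_succ, mul_right_comm, ih, ← add_assoc, Nat.factorial_succ (r + m + 1)]
    push_cast; ring

open scoped Nat in
theorem prod_range_sub_of_le (l r : ℕ) :
    (∏ j ∈ Finset.range l, (((l + r : ℕ) : ℂ) - j)) * r ! = (l + r)! := by
  induction l with
  | zero => simp
  | succ l ih =>
    rw [Finset.prod_range_succ', mul_right_comm]
    have : ∀ j ∈ Finset.range l, ((l + 1 + r : ℕ) : ℂ) - (j + 1 : ℕ) = ((l + r : ℕ) : ℂ) - j := by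
      intro j _; push_cast; ring
    rw [Finset.prod_congr rfl this, ih, show l + 1 + r = l + r + 1 by ring, Nat.factorial_succ]
    push_cast; ring

open scoped Nat in
/-- The coefficients of `C`. -/
def coefC (b l m i : ℕ) : ℂ :=
  (-1) ^ (i + 1) * ((b + m + 1)! * l ! * (b + i)!) / (i ! * (m - i)! * b ! * (b + l + 1 + i)!)

open scoped Nat in
/-- The coefficients of `D`. -/
def coefD (b l m i : ℕ) : ℂ :=
  (-1) ^ i * ((b + m + 1)! * l ! * (b + i)!) / (i ! * (l - i)! * b ! * (b + m + 1 + i)!)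

open scoped Nat in
theorem prod_div_range (a c i : ℕ) :
    ∏ j ∈ Finset.range i, ((a : ℂ) + 1 + j) / ((c : ℂ) + 1 + j) =
      ((a + i)! * c !) / (a ! * (c + i)!) := by
  induction i with
  | zero =>
    have h1 : (a ! : ℂ) ≠ 0 := by exact_mod_cast Nat.factorial_ne_zero _
    have h2 : (c ! : ℂ) ≠ 0 := by exact_mod_cast Nat.factorial_ne_zero _
    simp; field_simp
  | succ i ih =>
    have h1 : (a ! : ℂ) ≠ 0 := by exact_mod_cast Nat.factorial_ne_zero _
    have h2 : ((c + i)! : ℂ) ≠ 0 := by exact_mod_cast Nat.factorial_ne_zero _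
    have h3 : (c : ℂ) + 1 + i ≠ 0 := by exact_mod_cast (by omega : c + 1 + i ≠ 0)
    rw [Finset.prod_range_succ, ih, ← add_assoc, ← add_assoc, Nat.factorial_succ,
      Nat.factorial_succ]
    push_cast
    have h4 : (c : ℂ) + i + 1 ≠ 0 := by rwa [add_right_comm]
    rw [show (c : ℂ) + 1 + i = c + i + 1 by ring]
    field_simp
    ring

theorem sum_Icc_two {M : Type*} [AddCommMonoid M] (f : ℕ → M) (n : ℕ) :
    ∑ i ∈ Finset.Icc 2 (n + 1), f i = ∑ i ∈ Finset.range n, f (i + 2) := by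
  rw [Finset.range_eq_Ico, Finset.sum_Ico_add' f 0 n 2]
  congr 1

theorem prod_Icc_two {M : Type*} [CommMonoid M] (f : ℕ → M) (n : ℕ) :
    ∏ i ∈ Finset.Icc 2 (n + 1), f i = ∏ i ∈ Finset.range n, f (i + 2) := by
  rw [Finset.range_eq_Ico, Finset.prod_Ico_add' f 0 n 2]
  congr 1

theorem prod_Icc_one {M : Type*} [CommMonoid M] (f : ℕ → M) (n : ℕ) :
    ∏ i ∈ Finset.Icc 1 n, f i = ∏ i ∈ Finset.range n, f (i + 1) := by
  rw [Finset.range_eq_Ico, Finset.prod_Ico_add' f 0 n 1]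
  congr 1

theorem prod_Icc_succ {M : Type*} [CommMonoid M] (f : ℕ → M) (a n : ℕ) :
    ∏ i ∈ Finset.Icc (a + 1) (a + n), f i = ∏ i ∈ Finset.range n, f (a + 1 + i) := by
  rw [Finset.range_eq_Ico, Finset.prod_Ico_add f 0 n (a + 1)]
  refine Finset.prod_congr ?_ fun _ _ => rfl
  ext; simp; omega

open scoped Nat in
theorem choose_eq_div {n i : ℕ} (h : i ≤ n) :
    (n.choose i : ℂ) = n ! / (i ! * (n - i)!) := by
  rw [Nat.choose_eq_factorial_div_factorial h, Nat.cast_div (Nat.factorial_mul_factorial_dvd_factorial h)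
    (by exact_mod_cast mul_ne_zero (Nat.factorial_ne_zero _) (Nat.factorial_ne_zero _))]
  push_cast; rfl

theorem mon_congr {a a' : ℂ} {m m' n n' : ℕ} (h : a = a') (hm : m = m') (hn : n = n') :
    mon a m n = mon a' m' n' := by rw [h, hm, hn]

theorem C_mul_mon (a c : ℂ) (m n : ℕ) : C a * mon c m n = mon (a * c) m n := by
  simp only [mon, C_mul]; ring

-- In the parameters `d = b + l + m + 1`, `ν = l + m`, with the index of the form shifted to `l +
-- 1`, all products become quotients of factorials and the three multiplicities become `b + l`, `b +
-- m`, `l + m`.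
open scoped Nat in
theorem polyD_eq (b l m : ℕ) : polyD (b + l + m + 1) (l + 1) (l + m) =
    ∑ i ∈ Finset.range (l + 1), mon (coefD b l m i) (b + m + 1 + i) (l - i) := by
  rw [polyD, sum_Icc_two, Finset.sum_range_succ', add_comm]
  have hf : ∀ n : ℕ, (n ! : ℂ) ≠ 0 := fun n => by exact_mod_cast Nat.factorial_ne_zero _
  refine congrArg₂ (· + ·) ?_ ?_
  · refine Finset.sum_congr rfl fun i hi => ?_
    rw [Finset.mem_range] at hi
    rw [prod_Icc_two (n := i + 1)]
    have e : ∀ j ∈ Finset.range (i + 1),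
        (((b + l + m + 1 : ℕ) : ℂ) - ((l + m : ℕ) : ℂ) + ((j + 2 : ℕ) : ℂ) - 2) /
          (((b + l + m + 1 : ℕ) : ℂ) - ((l + 1 : ℕ) : ℂ) + ((j + 2 : ℕ) : ℂ)) =
        ((b : ℂ) + 1 + j) / (((b + m + 1 : ℕ) : ℂ) + 1 + j) := by
      intro j _; push_cast; congr 1 <;> ring
    rw [Finset.prod_congr rfl e, prod_div_range]
    refine mon_congr ?_ ?_ ?_
    · rw [show l + 1 - 1 = l by omega, show i + 2 - 1 = i + 1 by omega, choose_eq_div (by omega),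
        coefD]
      have := hf (i + 1); have := hf (l - (i + 1)); have := hf b; have := hf (b + m + 1 + (i + 1))
      field_simp
    · omega
    · omega
  · refine mon_congr ?_ ?_ ?_
    · rw [coefD]
      have := hf l; have := hf b; have := hf (b + m + 1)
      simp
      field_simp
    · omega
    · omega

open scoped Nat in
theorem polyC_eq (b l m : ℕ) (hlm : l ≤ m) (hm : 1 ≤ m) :
    polyC (b + l + m + 1) (l + 1) (l + m) =
    ∑ i ∈ Finset.range (m + 1), mon (coefC b l m i) (m - i) (b + l + 1 + i) := by
  have hf : ∀ n : ℕ, (n ! : ℂ) ≠ 0 := fun n => by exact_mod_cast Nat.factorial_ne_zero _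
  -- For `l = m = 0` truncated subtraction would give `1` here; `1 ≤ m` excludes this.
  rw [polyC, show l + m - (l + 1) + 1 = m by omega, show l + m - (l + 1) + 2 = m + 1 by omega,
    Finset.mul_sum]
  refine Finset.sum_congr rfl fun i hi => ?_
  rw [Finset.mem_range] at hi
  rw [C_mul_mon]
  obtain ⟨n, rfl⟩ := Nat.exists_eq_add_of_le hlm
  rw [prod_Icc_succ, prod_Icc_one]
  have e : ∀ j ∈ Finset.range n,
      (((b + l + (l + n) + 1 : ℕ) : ℂ) - ((l + (l + n) : ℕ) : ℂ) + ((l + 1 + j : ℕ) : ℂ)) /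
        ((l + 1 + j : ℕ) : ℂ) = (((b + l + 1 : ℕ) : ℂ) + 1 + j) / ((l : ℂ) + 1 + j) := by
    intro j _; push_cast; congr 1; ring
  have e' : ∀ j ∈ Finset.range i,
      (((b + l + (l + n) + 1 : ℕ) : ℂ) - ((l + (l + n) : ℕ) : ℂ) + ((j + 1 : ℕ) : ℂ) - 1) /
        (((b + l + (l + n) + 1 : ℕ) : ℂ) - ((l + (l + n) : ℕ) : ℂ) + ((l + 1 : ℕ) : ℂ) +
          ((j + 1 : ℕ) : ℂ) - 1) = ((b : ℂ) + 1 + j) / (((b + l + 1 : ℕ) : ℂ) + 1 + j) := by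
    intro j _; push_cast; congr 1 <;> ring
  rw [Finset.prod_congr rfl e, Finset.prod_congr rfl e', prod_div_range, prod_div_range]
  refine mon_congr ?_ ?_ ?_
  · rw [choose_eq_div (by omega), coefC, show b + (l + n) + 1 = b + l + 1 + n by omega]
    have := hf i; have := hf (l + n - i); have := hf b; have := hf (b + l + 1 + i)
    have := hf (b + l + 1); have := hf (l + n)
    field_simp
  · omega
  · omega

/-- At this value of `ν` the leading product of `polyC` runs over an empty interval. -/
theorem polyA_eq_polyC (d l : ℕ) (hl : l ≠ 0) (hd : 2 * l + 1 ≤ d) :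
    polyA d (l + 1) = polyC d (l + 1) (2 * l) := by
  rw [polyA, polyC, sum_Icc_two, show 2 * l - (l + 1) + 1 = l by omega,
    show 2 * l - (l + 1) + 2 = l + 1 by omega, Finset.Icc_eq_empty (by omega), Finset.prod_empty,
    C_1, one_mul, Finset.sum_range_succ', add_comm]
  refine congrArg₂ (· + ·) ?_ ?_
  · refine Finset.sum_congr rfl fun i hi => ?_
    rw [coefAB, prod_Icc_one, prod_Icc_two]
    refine mon_congr ?_ ?_ ?_
    · rw [show l + 1 - 1 = l by omega, show i + 2 - 1 = i + 1 by omega, ← mul_assoc]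
      refine congrArg₂ (· * ·) (by ring) ?_
      · refine Finset.prod_congr rfl fun j _ => ?_
        push_cast; congr 1 <;> ring
    · omega
    · omega
  · simp only [mon]
    rw [show l + 1 - 1 = l - 0 by omega, show d - (l + 1) + 1 = d - 2 * l + (l + 1) - 1 + 0 by omega]
    simp

theorem polyB_eq_polyD (d l : ℕ) : polyB d (l + 1) = polyD d (l + 1) (2 * l) := by
  rw [polyB, polyD]
  refine congrArg₂ (· + ·) rfl ?_
  refine Finset.sum_congr rfl fun i hi => ?_
  rw [coefAB, ← mul_assoc]
  refine mon_congr (congrArg₂ (· * ·) rfl ?_) rfl rfl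
  refine Finset.prod_congr rfl fun j _ => ?_
  push_cast; congr 1; ring

-- Up to a factor independent of `i`, the coefficient is the inverse of the Lagrange denominator at
-- the node `l - i`, for the nodes `0, …, l` and `b + l + 1, …, b + l + m + 1`. These nodes are the
-- exponents of `y` in `D` and in `C`.
open scoped Nat in
theorem coefD_eq_div (b l m i : ℕ) (hi : i ≤ l) : coefD b l m i =
    (-1) ^ (m + 1) * ((b + m + 1)! * l !) / b ! /
      ((∏ j ∈ (Finset.range (l + 1)).erase (l - i), (((l - i : ℕ) : ℂ) - j)) *
        ∏ j ∈ Finset.range (m + 1), (((l - i : ℕ) : ℂ) - ((b + l + 1 : ℕ) + j))) := by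
  have hf : ∀ n : ℕ, (n ! : ℂ) ≠ 0 := fun n => by exact_mod_cast Nat.factorial_ne_zero _
  have h1 := prod_erase_sub (l - i) i
  rw [show l - i + 1 + i = l + 1 by omega] at h1
  have h2 := prod_range_sub_of_lt (l - i) (b + i) m
  rw [show l - i + (b + i) + 1 = b + l + 1 by omega, ← eq_div_iff (hf _)] at h2
  have hs : ((-1 : ℂ) ^ i) * (-1) ^ i = 1 := by rw [← mul_pow]; simp
  rw [h1, h2, coefD, show b + i + m + 1 = b + m + 1 + i by omega]
  have := hf (b + i); have := hf (b + m + 1 + i); have := hf b; have := hf i; have := hf (l - i)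
  have h3 : ((-1 : ℂ) ^ i) ≠ 0 := pow_ne_zero _ (by norm_num)
  have h4 : ((-1 : ℂ) ^ (m + 1)) ≠ 0 := pow_ne_zero _ (by norm_num)
  rw [show ((-1 : ℂ) ^ i) = 1 / (-1) ^ i from (eq_div_iff h3).2 hs]
  field_simp
  rw [pow_two, hs, one_mul]

open scoped Nat in
theorem coefC_eq_div (b l m i : ℕ) (hi : i ≤ m) : coefC b l m i =
    (-1) ^ (m + 1) * ((b + m + 1)! * l !) / b ! /
      ((∏ j ∈ Finset.range (l + 1), ((b + l + 1 : ℕ) + (i : ℂ) - j)) *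
        ∏ j ∈ (Finset.range (m + 1)).erase i,
          ((b + l + 1 : ℕ) + (i : ℂ) - ((b + l + 1 : ℕ) + j))) := by
  have hf : ∀ n : ℕ, (n ! : ℂ) ≠ 0 := fun n => by exact_mod_cast Nat.factorial_ne_zero _
  have h1 := prod_erase_sub i (m - i)
  rw [show i + 1 + (m - i) = m + 1 by omega] at h1
  have h2 := prod_range_sub_of_le (l + 1) (b + i)
  rw [show l + 1 + (b + i) = b + l + 1 + i by omega, ← eq_div_iff (hf _)] at h2
  have hs : ((-1 : ℂ) ^ (i + 1)) * (-1) ^ (m - i) = (-1) ^ (m + 1) := by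
    rw [← pow_add]; congr 1; omega
  simp only [add_sub_add_left_eq_sub]
  rw [h1, ← Nat.cast_add, h2, coefC]
  have := hf (b + i); have := hf (b + l + 1 + i); have := hf b; have := hf i; have := hf (m - i)
  have h4 : ((-1 : ℂ) ^ (m - i)) ≠ 0 := pow_ne_zero _ (by norm_num)
  rw [← hs]
  field_simp

/-! ### The interpolation identity behind the forms `C` and `D` -/

theorem disjSum_erase_inl {α β : Type*} [DecidableEq α] [DecidableEq β] (s : Finset α)
    (t : Finset β) (a : α) : (s.disjSum t).erase (Sum.inl a) = (s.erase a).disjSum t := by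
  ext x; cases x <;> simp

theorem disjSum_erase_inr {α β : Type*} [DecidableEq α] [DecidableEq β] (s : Finset α)
    (t : Finset β) (b : β) : (s.disjSum t).erase (Sum.inr b) = s.disjSum (t.erase b) := by
  ext x; cases x <;> simp

/-- Lagrange interpolation on these `l + m + 2` nodes expresses the coefficient of degree `l + m +
1` of `P` as the sum of its values over the denominators; for `P` of smaller degree that coefficient
is zero. -/
theorem sum_coef_mul_eval_eq_zero (b l m : ℕ) (P : Polynomial ℂ)
    (hP : P.degree < (l + m + 1 : ℕ)) :
    ∑ i ∈ Finset.range (m + 1), coefC b l m i * P.eval (((b + l + 1 : ℕ) : ℂ) + i) +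
      ∑ i ∈ Finset.range (l + 1), coefD b l m i * P.eval ((l - i : ℕ) : ℂ) = 0 := by
  set s := (Finset.range (l + 1)).disjSum (Finset.range (m + 1)) with hs
  set v : ℕ ⊕ ℕ → ℂ := Sum.elim (fun j => (j : ℂ)) (fun j => ((b + l + 1 : ℕ) : ℂ) + j) with hv
  have hinj : Set.InjOn v s := by
    rintro (x | x) hx (y | y) hy hxy <;> simp only [hv, Sum.elim_inl, Sum.elim_inr, hs,
      Finset.mem_coe, Finset.inl_mem_disjSum, Finset.inr_mem_disjSum, Finset.mem_range] at hx hy hxy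
    · rw [Nat.cast_inj.1 hxy]
    · norm_cast at hxy; omega
    · norm_cast at hxy; omega
    · rw [Nat.cast_inj.1 (add_left_cancel hxy)]
  have hcard : s.card = l + m + 2 := by
    rw [hs, Finset.card_disjSum, Finset.card_range, Finset.card_range]; ring
  have key := Lagrange.coeff_eq_sum hinj (P := P)
    (hP.trans (by rw [hcard]; exact_mod_cast Nat.lt_succ_self _))
  rw [hcard, show l + m + 2 - 1 = l + m + 1 by omega, Polynomial.coeff_eq_zero_of_degree_lt hP, hs, Finset.sum_disjSum] at key
  simp only [disjSum_erase_inl, disjSum_erase_inr, Finset.prod_disjSum, hv, Sum.elim_inl,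
    Sum.elim_inr] at key
  -- The `i`-th coefficient of `D` belongs to the node `l - i`.
  rw [← Finset.sum_range_reflect] at key
  rw [← mul_zero ((-1) ^ (m + 1) * (((b + m + 1).factorial : ℂ) * l.factorial) / b.factorial), key,
    mul_add, add_comm, Finset.mul_sum, Finset.mul_sum]
  refine congrArg₂ (· + ·) ?_ ?_
  · refine Finset.sum_congr rfl fun i hi => ?_
    rw [Finset.mem_range] at hi
    rw [coefD_eq_div b l m i (by omega), show l + 1 - 1 - i = l - i by omega]
    ring
  · refine Finset.sum_congr rfl fun i hi => ?_
    rw [Finset.mem_range] at hi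
    rw [coefC_eq_div b l m i (by omega)]
    ring

/-- Falling factorials are the test polynomials; the sums are then the Taylor coefficients at `y =
1` of `C + D` restricted to `x = 1`. -/
theorem sum_coef_mul_choose_eq_zero (b l m k : ℕ) (hk : k < l + m + 1) :
    ∑ i ∈ Finset.range (m + 1), coefC b l m i * ((b + l + 1 + i).choose k : ℂ) +
      ∑ i ∈ Finset.range (l + 1), coefD b l m i * ((l - i).choose k : ℂ) = 0 := by
  have h := sum_coef_mul_eval_eq_zero b l m (descPochhammer ℂ k) (by
    rw [Polynomial.degree_eq_natDegree (monic_descPochhammer ℂ k).ne_zero,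
      descPochhammer_natDegree]
    exact_mod_cast hk)
  have hf : (k.factorial : ℂ) ≠ 0 := by exact_mod_cast Nat.factorial_ne_zero _
  apply mul_left_cancel₀ hf
  rw [mul_zero, ← h, mul_add, Finset.mul_sum, Finset.mul_sum]
  refine congrArg₂ (· + ·) ?_ ?_ <;> refine Finset.sum_congr rfl fun i _ => ?_
  · rw [← Nat.cast_add, descPochhammer_eval_eq_descFactorial,
      Nat.descFactorial_eq_factorial_mul_choose]
    push_cast; ring
  · rw [descPochhammer_eval_eq_descFactorial, Nat.descFactorial_eq_factorial_mul_choose]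
    push_cast; ring

/-! ### The explicit forms have three fixed critical points -/

theorem along_mon (c : ℂ) (m n : ℕ) : along ![1, 1] ![0, 1] (mon c m n) =
    Polynomial.C c * (1 + Polynomial.X) ^ n := by
  simp [along, mon]

theorem isHomogeneous_mon (c : ℂ) {m n d : ℕ} (h : m + n = d) : (mon c m n).IsHomogeneous d := by
  rw [← h, mon]
  exact ((isHomogeneous_X_pow _ _).C_mul c).mul (isHomogeneous_X_pow _ _)

theorem eval_mon (c : ℂ) (m n : ℕ) (v : Fin 2 → ℂ) : eval v (mon c m n) = c * v 0 ^ m * v 1 ^ n := by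
  simp [mon]

theorem X_zero_pow_dvd_mon (c : ℂ) {m n k : ℕ} (h : k ≤ m) : X 0 ^ k ∣ mon c m n := by
  exact Dvd.dvd.mul_right (Dvd.dvd.mul_left (pow_dvd_pow _ h) _) _

theorem X_one_pow_dvd_mon (c : ℂ) {m n k : ℕ} (h : k ≤ n) : X 1 ^ k ∣ mon c m n := by
  exact Dvd.dvd.mul_left (pow_dvd_pow _ h) _

/-- The critical points of the normal forms. -/
def stdPoint : Fin 3 → Fin 2 → ℂ := ![![1, 0], ![0, 1], ![1, 1]]

theorem wedge_stdPoint (i j : Fin 3) (h : i ≠ j) : wedge (stdPoint i) (stdPoint j) ≠ 0 := by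
  fin_cases i <;> fin_cases j <;> simp [stdPoint, wedge] at h ⊢

theorem lineThrough_pow_dvd_of_X_one {F : Binary} {k : ℕ} (h : X 1 ^ k ∣ F) :
    lineThrough ![1, 0] ^ k ∣ F := by
  have : lineThrough ![1, 0] = - X 1 := by simp [lineThrough]
  rw [this, neg_pow]
  exact (IsUnit.mul_left_dvd (IsUnit.pow _ isUnit_one.neg)).2 h

theorem lineThrough_pow_dvd_of_X_zero {F : Binary} {k : ℕ} (h : X 0 ^ k ∣ F) :
    lineThrough ![0, 1] ^ k ∣ F := by
  have : lineThrough ![0, 1] = X 0 := by simp [lineThrough]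
  rwa [this]

theorem sum_forms_dvd (b l m : ℕ) (hlm : l ≤ m) (hm : 1 ≤ m) :
    lineThrough ![1, 1] ^ (l + m + 1) ∣ polyC (b + l + m + 1) (l + 1) (l + m) +
      polyD (b + l + m + 1) (l + 1) (l + m) := by
  rw [polyC_eq b l m hlm hm, polyD_eq]
  rw [lineThrough_pow_dvd_iff (w := ![0, 1]) (m := b + l + m + 1) (by simp [wedge])]
  · rw [Polynomial.X_pow_dvd_iff]
    intro k hk
    refine Eq.trans ?_ (sum_coef_mul_choose_eq_zero b l m k hk)
    simp only [map_add, map_sum, along_mon, Polynomial.coeff_add, Polynomial.finsetSum_coeff,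
      Polynomial.coeff_C_mul, Polynomial.coeff_one_add_X_pow]
  · refine IsHomogeneous.add (IsHomogeneous.sum _ _ _ fun i hi => ?_)
      (IsHomogeneous.sum _ _ _ fun i hi => ?_) <;> rw [Finset.mem_range] at hi <;>
      exact isHomogeneous_mon _ (by omega)

theorem coefD_ne_zero (b l m i : ℕ) : coefD b l m i ≠ 0 := by
  have hf : ∀ n : ℕ, (n.factorial : ℂ) ≠ 0 := fun n => by exact_mod_cast Nat.factorial_ne_zero _
  have h4 : ((-1 : ℂ) ^ i) ≠ 0 := pow_ne_zero _ (by norm_num)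
  simp [coefD, hf]

theorem coefC_ne_zero (b l m i : ℕ) : coefC b l m i ≠ 0 := by
  have hf : ∀ n : ℕ, (n.factorial : ℂ) ≠ 0 := fun n => by exact_mod_cast Nat.factorial_ne_zero _
  simp [coefC, hf]

theorem threeCritical_stdForm (b l m : ℕ) (hlm : l ≤ m) (hm : 1 ≤ m) (hb : m ≤ b) :
    ThreeCritical (b + l + m + 1) (polyC (b + l + m + 1) (l + 1) (l + m))
      (polyD (b + l + m + 1) (l + 1) (l + m)) stdPoint ![b + l, b + m, l + m] := by
  have hC := polyC_eq b l m hlm hm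
  have hD := polyD_eq b l m
  have hCD := sum_forms_dvd b l m hlm hm
  set P := polyC (b + l + m + 1) (l + 1) (l + m)
  set Q := polyD (b + l + m + 1) (l + 1) (l + m)
  have hdP : X 1 ^ (b + l + 1) ∣ P := by
    rw [hC]
    exact Finset.dvd_sum fun i _ => X_one_pow_dvd_mon _ (by omega)
  have hdQ : X 0 ^ (b + m + 1) ∣ Q := by
    rw [hD]
    exact Finset.dvd_sum fun i _ => X_zero_pow_dvd_mon _ (by omega)
  have f0 : fixForm P Q ![1, 0] = P := by simp [fixForm]
  refine threeCritical_of_dvd ?_ ?_ wedge_stdPoint ?_ ?_ ?_ ?_ ?_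
  · rw [hC]
    refine IsHomogeneous.sum _ _ _ fun i hi => ?_
    rw [Finset.mem_range] at hi
    exact isHomogeneous_mon _ (by omega)
  · rw [hD]
    refine IsHomogeneous.sum _ _ _ fun i hi => ?_
    rw [Finset.mem_range] at hi
    exact isHomogeneous_mon _ (by omega)
  · intro i; fin_cases i
    · change 1 ≤ b + l; omega
    · change 1 ≤ b + m; omega
    · change 1 ≤ l + m; omega
  · rw [Fin.sum_univ_three]
    change b + l + (b + m) + (l + m) + 2 = _
    omega
  · intro i; fin_cases i
    · change lineThrough ![1, 0] ^ (b + l + 1) ∣ fixForm P Q ![1, 0]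
      rw [f0]
      exact lineThrough_pow_dvd_of_X_one hdP
    · change lineThrough ![0, 1] ^ (b + m + 1) ∣ fixForm P Q ![0, 1]
      have f1 : fixForm P Q ![0, 1] = Q := by simp [fixForm]
      rw [f1]
      exact lineThrough_pow_dvd_of_X_zero hdQ
    · change lineThrough ![1, 1] ^ (l + m + 1) ∣ fixForm P Q ![1, 1]
      have f2 : fixForm P Q ![1, 1] = P + Q := by simp [fixForm]
      rw [f2]
      exact hCD
  · intro _
    change eval ![1, 0] Q ≠ 0
    -- At `(1, 0)` only the last monomial of `D`, a pure power of `x`, survives.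
    rw [hD, map_sum, Finset.sum_range_succ, Finset.sum_eq_zero]
    · simp [eval_mon, coefD_ne_zero]
    · intro i hi
      rw [Finset.mem_range] at hi
      rw [eval_mon]
      simp; omega
  · change fixForm P Q ![1, 0] ≠ 0
    rw [f0]
    intro hP
    have h0 : eval ![0, 1] P = 0 := by rw [hP, map_zero]
    -- At `(0, 1)` only the last monomial of `C`, a pure power of `y`, survives.
    rw [hC, map_sum, Finset.sum_range_succ, Finset.sum_eq_zero] at h0
    · simp [eval_mon, coefC_ne_zero] at h0
    · intro i hi
      rw [Finset.mem_range] at hi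
      rw [eval_mon]
      simp; omega

theorem threeCritical_polyC_polyD {d l ν : ℕ} (hl : 1 ≤ l) (hν : 1 ≤ ν) (h1 : 2 * l ≤ ν + 2)
    (h2 : 2 * ν + 2 ≤ d + l) :
    ThreeCritical d (polyC d l ν) (polyD d l ν) stdPoint ![d + l - 2 - ν, d - l, ν] := by
  obtain ⟨l, rfl⟩ := Nat.exists_eq_add_of_le' hl
  obtain ⟨m, rfl⟩ := Nat.exists_eq_add_of_le (show l ≤ ν by omega)
  obtain ⟨b, rfl⟩ : ∃ b, d = b + l + m + 1 := ⟨d - (l + m + 1), by omega⟩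
  rw [show b + l + m + 1 + (l + 1) - 2 - (l + m) = b + l by omega,
    show b + l + m + 1 - (l + 1) = b + m by omega]
  exact threeCritical_stdForm b l m (by omega) (by omega) (by omega)

/-! ## The foliation defined by a pair of binary forms -/

/-- Binary polynomials as polynomials in three variables. -/
abbrev extend : Binary →ₐ[ℂ] MvPolynomial (Fin 3) ℂ := rename Fin.castSucc

/-- The first two coordinates. -/
def trunc (v : Fin 3 → ℂ) : Fin 2 → ℂ := v ∘ Fin.castSucc

theorem extend_injective : Function.Injective extend :=
  rename_injective _ (Fin.castSucc_injective 2)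

theorem eval_extend (v : Fin 3 → ℂ) (F : Binary) : eval v (extend F) = eval (trunc v) F :=
  eval_rename _ _ _

theorem extend_X_zero : extend (X 0) = X 0 := rename_X _ _

theorem extend_X_one : extend (X 1) = X 1 := rename_X _ _

theorem pderiv_zero_extend (F : Binary) : pderiv 0 (extend F) = extend (pderiv 0 F) :=
  pderiv_rename (Fin.castSucc_injective 2) 0 F

theorem pderiv_one_extend (F : Binary) : pderiv 1 (extend F) = extend (pderiv 1 F) :=
  pderiv_rename (Fin.castSucc_injective 2) 1 F

theorem pderiv_two_extend (F : Binary) : pderiv 2 (extend F) = 0 := by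
  classical
  refine pderiv_eq_zero_of_notMem_vars fun h => ?_
  obtain ⟨i, -, hi⟩ := Finset.mem_image.1 (vars_rename _ _ h)
  fin_cases i <;> simp at hi

theorem prime_X_fin {n : ℕ} (i : Fin n) : Prime (X i : MvPolynomial (Fin n) ℂ) :=
  (irreducible_of_isHomogeneous_one (isHomogeneous_X _ _) (X_ne_zero _)).prime

theorem fin_three_cases (i : Fin 3) : i = 0 ∨ i = 1 ∨ i = 2 := by
  fin_cases i <;> simp

theorem formOf_apply (V : Triple) : formOf V =
    ![X 1 * V 2 - X 2 * V 1, X 2 * V 0 - X 0 * V 2, X 0 * V 1 - X 1 * V 0] := by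
  rw [formOf, cross_apply]

theorem formOf_affineForm (A B : Binary) : formOf (affineForm A B) =
    ![X 2 * extend A, X 2 * extend B, - extend (X 0 * A + X 1 * B)] := by
  rw [formOf_apply, map_add, map_mul, map_mul, extend_X_zero, extend_X_one]
  funext i; fin_cases i <;> simp [affineForm]
  ring

theorem formOf_affineForm_zero (A B : Binary) :
    formOf (affineForm A B) 0 = X 2 * extend A := by
  rw [formOf_affineForm]; rfl

theorem formOf_affineForm_one (A B : Binary) :
    formOf (affineForm A B) 1 = X 2 * extend B := by
  rw [formOf_affineForm]; rfl

theorem formOf_affineForm_two (A B : Binary) :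
    formOf (affineForm A B) 2 = - extend (X 0 * A + X 1 * B) := by
  rw [formOf_affineForm]; rfl

/-! ### Invariant lines and the inflection divisor -/

theorem lieD_mul (V : Triple) (f g : MvPolynomial (Fin 3) ℂ) :
    lieD V (f * g) = f * lieD V g + g * lieD V f := by
  simp only [lieD, Derivation.leibniz, smul_eq_mul, Finset.mul_sum, ← Finset.sum_add_distrib]
  refine Finset.sum_congr rfl fun i _ => ?_
  ring

theorem lieD_X (V : Triple) (i : Fin 3) : lieD V (X i) = V i := by
  simp [lieD, pderiv_X, Pi.single_apply]

theorem lieD_affineForm_extend (A B F : Binary) :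
    lieD (affineForm A B) (extend F) = extend (B * pderiv 0 F - A * pderiv 1 F) := by
  simp only [lieD, Fin.sum_univ_three, pderiv_zero_extend, pderiv_one_extend, pderiv_two_extend,
    affineForm, map_sub, map_mul]
  simp [sub_eq_add_neg]

theorem isInvariantCurve_of_associated {V : Triple} {h ℓ : MvPolynomial (Fin 3) ℂ}
    (ha : Associated ℓ h) (hℓ : IsInvariantCurve V ℓ) : IsInvariantCurve V h := by
  obtain ⟨u, rfl⟩ := ha
  rw [IsInvariantCurve, lieD_mul, u.isUnit.mul_right_dvd]
  exact dvd_add (Dvd.intro _ rfl) (Dvd.dvd.mul_left hℓ _)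

theorem lieD_affineForm_lineThrough (A B : Binary) (v : Fin 2 → ℂ) :
    lieD (affineForm A B) (extend (lineThrough v)) = extend (fixForm A B v) := by
  rw [lieD_affineForm_extend]
  congr 1
  simp [lineThrough, fixForm, pderiv_X]
  ring

theorem eval_fixForm_self (A B : Binary) (v : Fin 2 → ℂ) :
    eval v (fixForm A B v) = eval v (X 0 * A + X 1 * B) := by
  simp [fixForm]

theorem extend_lineThrough_dvd_iff {F : Binary} {n : ℕ} (hF : F.IsHomogeneous n) {v : Fin 2 → ℂ}
    (hv : v ≠ 0) : extend (lineThrough v) ∣ extend F ↔ eval v F = 0 := by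
  constructor
  · rintro ⟨G, hG⟩
    have h := congrArg (eval ![v 0, v 1, 0]) hG
    have ht : trunc ![v 0, v 1, 0] = v := by
      funext i; fin_cases i <;> rfl
    rw [map_mul, eval_extend, eval_extend, ht, eval_lineThrough, wedge_self] at h
    simpa using h
  · intro h
    exact map_dvd extend (lineThrough_dvd_of_eval_eq_zero hF hv h)

/-- The line `[v]` is invariant iff `v` is a fixed point. -/
theorem isInvariantCurve_lineThrough_iff {A B : Binary} {d : ℕ} (hA : A.IsHomogeneous d)
    (hB : B.IsHomogeneous d) {v : Fin 2 → ℂ} (hv : v ≠ 0) :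
    IsInvariantCurve (affineForm A B) (extend (lineThrough v)) ↔ eval v (fixForm A B v) = 0 := by
  rw [IsInvariantCurve, lieD_affineForm_lineThrough,
    extend_lineThrough_dvd_iff (isHomogeneous_fixForm hA hB v) hv]

/-- The field has no `z`-component, so the determinant is `z` times a minor involving derivatives of
`A` and `B`. Euler's identity for `d A` and `d B` factors this minor; this is the origin of the
constant `d`. -/
theorem inflection_affineForm {A B : Binary} {d : ℕ} (hA : A.IsHomogeneous d)
    (hB : B.IsHomogeneous d) : C (d : ℂ) * inflection (affineForm A B) =
      - (X 2 * extend ((X 0 * A + X 1 * B) * jac A B)) := by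
  have hneg : ∀ V f, lieD V (-f) = - lieD V f := by
    intro V f; simp [lieD]
  have h0 : ∀ V, lieD V 0 = 0 := by
    intro V; simp [lieD]
  have e0 : affineForm A B 0 = extend B := rfl
  have e1 : affineForm A B 1 = - extend A := rfl
  have e2 : affineForm A B 2 = 0 := rfl
  have hinf : inflection (affineForm A B) = X 2 * extend
      (-(B * (B * pderiv 0 A - A * pderiv 1 A)) + A * (B * pderiv 0 B - A * pderiv 1 B)) := by
    rw [inflection, Matrix.det_fin_three]
    simp [lieD_X, e0, e1, e2, hneg, h0, lieD_affineForm_extend]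
    ring
  have hEA := hA.sum_X_mul_pderiv
  have hEB := hB.sum_X_mul_pderiv
  rw [Fin.sum_univ_two, nsmul_eq_mul] at hEA hEB
  have hC : C (d : ℂ) = extend (d : Binary) := by
    rw [map_natCast, map_natCast]
  rw [hinf, hC, mul_left_comm, ← map_mul, ← mul_neg (X 2 : MvPolynomial (Fin 3) ℂ),
    ← map_neg extend]
  refine congrArg (fun q => X 2 * extend q) ?_
  simp only [jac]
  linear_combination (-(B * pderiv 0 B) + A * pderiv 1 B) * hEA +
    (B * pderiv 0 A - A * pderiv 1 A) * hEB

/-- Otherwise `A = y q` and `B = -x q` with `q` of degree `d - 1 ≥ 1`, and a zero of `q` is common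
to `A` and `B`. -/
theorem fixedPoints_ne_zero {A B : Binary} {d : ℕ} (hd : 2 ≤ d) (hA : A.IsHomogeneous d)
    (hB : B.IsHomogeneous d) (hAB : IsRelPrime A B) : X 0 * A + X 1 * B ≠ 0 := by
  intro h
  have hp : Prime (X 1 : Binary) := prime_X_fin 1
  have h1 : (X 1 : Binary) ∣ X 0 * A := ⟨-B, by linear_combination h⟩
  have h2 : (X 1 : Binary) ∣ A := by
    refine (hp.dvd_or_dvd h1).resolve_left fun h3 => ?_
    rw [X_dvd_X] at h3
    simp at h3
  obtain ⟨q, rfl⟩ := h2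
  have hBq : B = -(X 0 * q) := by
    apply mul_left_cancel₀ hp.ne_zero
    linear_combination h
  obtain ⟨e, rfl⟩ : ∃ e, d = 1 + (e + 1) := ⟨d - 2, by omega⟩
  have hq := isHomogeneous_of_mul_left (isHomogeneous_X ℂ (1 : Fin 2)) hp.ne_zero hA
  obtain ⟨v, hv, hv0⟩ := exists_zero_of_isHomogeneous hq
  refine no_common_zero_of_isRelPrime hA hB hAB hv ?_ ?_
  · rw [map_mul, hv0, mul_zero]
  · rw [hBq, map_neg, map_mul, hv0, mul_zero, neg_zero]

theorem isHomogeneous_fixedPoints {A B : Binary} {d : ℕ} (hA : A.IsHomogeneous d)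
    (hB : B.IsHomogeneous d) : (X 0 * A + X 1 * B).IsHomogeneous (1 + d) :=
  ((isHomogeneous_X _ _).mul hA).add ((isHomogeneous_X _ _).mul hB)

theorem irreducible_extend_lineThrough {v : Fin 2 → ℂ} (hv : v ≠ 0) :
    Irreducible (extend (lineThrough v)) :=
  irreducible_of_isHomogeneous_one (isHomogeneous_lineThrough v).rename_isHomogeneous
    fun h => lineThrough_ne_zero hv (extend_injective (h.trans (map_zero _).symm))

theorem exists_associated_lineThrough {h : MvPolynomial (Fin 3) ℂ} (hh : Prime h) {F : Binary}
    {n : ℕ} (hF : F.IsHomogeneous n) (hF0 : F ≠ 0) (hd : h ∣ extend F) :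
    ∃ v : Fin 2 → ℂ, v ≠ 0 ∧ eval v F = 0 ∧ Associated h (extend (lineThrough v)) := by
  obtain ⟨v, hv, hv0, hd⟩ := exists_lineThrough_of_prime_dvd extend.toRingHom hh hF hF0 hd
  exact ⟨v, hv, hv0, hh.irreducible.associated_of_dvd (irreducible_extend_lineThrough hv) hd⟩

theorem isHomogeneous_affineForm {A B : Binary} {d : ℕ} (hA : A.IsHomogeneous d)
    (hB : B.IsHomogeneous d) (i : Fin 3) : (affineForm A B i).IsHomogeneous d := by
  fin_cases i
  · exact hB.rename_isHomogeneous
  · exact hA.rename_isHomogeneous.neg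
  · exact isHomogeneous_zero _ _ _

theorem isConvex_affineForm {A B : Binary} {d : ℕ} (hd : 2 ≤ d) (hA : A.IsHomogeneous d)
    (hB : B.IsHomogeneous d) (hAB : IsRelPrime A B) (hJ : jac A B ≠ 0)
    (hfix : ∀ u : Fin 2 → ℂ, u ≠ 0 → eval u (jac A B) = 0 → eval u (fixForm A B u) = 0) :
    IsConvex (affineForm A B) := by
  intro h hirr hdvd
  have hp := hirr.prime
  have h1 : h ∣ X 2 * extend ((X 0 * A + X 1 * B) * jac A B) := by
    rw [← dvd_neg, ← inflection_affineForm hA hB]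
    exact hdvd.mul_left _
  have key : ∀ v : Fin 2 → ℂ, v ≠ 0 → eval v (fixForm A B v) = 0 →
      Associated h (extend (lineThrough v)) → IsInvariantCurve (affineForm A B) h :=
    fun v hv hv0 hass => isInvariantCurve_of_associated hass.symm
      ((isInvariantCurve_lineThrough_iff hA hB hv).2 hv0)
  rcases hp.dvd_or_dvd h1 with h2 | h2
  · refine isInvariantCurve_of_associated
      (hirr.associated_of_dvd (prime_X_fin (2 : Fin 3)).irreducible h2).symm ?_
    rw [IsInvariantCurve, lieD_X]
    exact dvd_zero _
  · rw [map_mul] at h2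
    rcases hp.dvd_or_dvd h2 with h3 | h3
    · obtain ⟨v, hv, hv0, hass⟩ := exists_associated_lineThrough hp
        (isHomogeneous_fixedPoints hA hB) (fixedPoints_ne_zero hd hA hB hAB) h3
      exact key v hv (by rw [eval_fixForm_self, hv0]) hass
    · obtain ⟨v, hv, hv0, hass⟩ := exists_associated_lineThrough hp (isHomogeneous_jac hA hB) hJ h3
      exact key v hv (hfix v hv hv0) hass

/-- A common irreducible factor of `z A`, `z B` and `x A + y B` is not `z`, since the last form is
nonzero and free of `z`; so it divides `A` and `B`. -/
theorem isFoliation_affineForm {A B : Binary} {d : ℕ} (hd : 2 ≤ d) (hA : A.IsHomogeneous d)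
    (hB : B.IsHomogeneous d) (hAB : IsRelPrime A B) : IsFoliation d (affineForm A B) := by
  refine ⟨isHomogeneous_affineForm hA hB, fun g hg => ?_⟩
  have hC := fixedPoints_ne_zero hd hA hB hAB
  rw [formOf_affineForm] at hg
  have g0 : g ∣ X 2 * extend A := hg 0
  have g1 : g ∣ X 2 * extend B := hg 1
  have g2 : g ∣ extend (X 0 * A + X 1 * B) := (dvd_neg.1 (hg 2 : g ∣ - _))
  by_contra hu
  have hg0 : g ≠ 0 := by
    rintro rfl
    rw [zero_dvd_iff] at g2
    exact hC (extend_injective (g2.trans (map_zero _).symm))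
  obtain ⟨h, hirr, hhg⟩ := WfDvdMonoid.exists_irreducible_factor hu hg0
  have hp := hirr.prime
  have hX2 : ¬ h ∣ X 2 := by
    intro h2
    have hass := hirr.associated_of_dvd (prime_X_fin (2 : Fin 3)).irreducible h2
    have h3 : X 2 ∣ extend (X 0 * A + X 1 * B) := hass.dvd_iff_dvd_left.1 (hhg.trans g2)
    apply hC
    apply MvPolynomial.funext
    intro w
    obtain ⟨q, hq⟩ := h3
    have h4 := congrArg (eval ![w 0, w 1, 0]) hq
    have ht : trunc ![w 0, w 1, 0] = w := by
      funext i; fin_cases i <;> rfl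
    rw [eval_extend, ht] at h4
    rw [h4]; simp
  have hA' := (hp.dvd_or_dvd (hhg.trans g0)).resolve_left hX2
  have hB' := (hp.dvd_or_dvd (hhg.trans g1)).resolve_left hX2
  have hA0 : A ≠ 0 := by
    rintro rfl
    obtain ⟨e, rfl⟩ : ∃ e, d = e + 1 := ⟨d - 1, by omega⟩
    obtain ⟨v, hv, hv0⟩ := exists_zero_of_isHomogeneous hB
    exact no_common_zero_of_isRelPrime hA hB hAB hv (map_zero _) hv0
  obtain ⟨v, hv, hv0, hass⟩ := exists_associated_lineThrough hp hA hA0 hA'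
  exact no_common_zero_of_isRelPrime hA hB hAB hv hv0
    ((extend_lineThrough_dvd_iff hB hv).1 (hass.dvd_iff_dvd_left.1 hB'))

/-! ### Radial singularities on the line at infinity -/

theorem along_extend (v w : Fin 3 → ℂ) (F : Binary) :
    along v w (extend F) = along (trunc v) (trunc w) F := by
  rw [along, aeval_rename]; rfl

theorem along_X {n : ℕ} (v w : Fin n → ℂ) (i : Fin n) :
    along v w (X i) = Polynomial.C (v i) + Polynomial.C (w i) * Polynomial.X := aeval_X _ _

theorem along_C {n : ℕ} (v w : Fin n → ℂ) (c : ℂ) : along v w (C c) = Polynomial.C c :=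
  aeval_C _ _

theorem lineRestriction_eq (V : Triple) (v w : Fin 3 → ℂ) :
    lineRestriction V v w = ∑ i, along v w (formOf V i) * Polynomial.C (w i) := rfl

/-- On such a line `z` restricts to `w₂ t`, and the terms `w₂ t (w₀ A + w₁ B)` from `dx`, `dy`
cancel against those from `dz`. -/
theorem lineRestriction_affineForm (A B : Binary) {v : Fin 3 → ℂ} (hv : v 2 = 0) (w : Fin 3 → ℂ) :
    lineRestriction (affineForm A B) v w =
      - (Polynomial.C (w 2) * along (trunc v) (trunc w) (fixForm A B (trunc v))) := by
  rw [lineRestriction_eq, formOf_affineForm, Fin.sum_univ_three]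
  simp only [Matrix.cons_val_zero, Matrix.cons_val_one, Matrix.cons_val, map_mul, map_neg, map_add,
    along_extend, along_X, along_C, fixForm, hv, map_zero]
  have h0 : ∀ u : Fin 3 → ℂ, trunc u 0 = u 0 := fun _ => rfl
  have h1 : ∀ u : Fin 3 → ℂ, trunc u 1 = u 1 := fun _ => rfl
  simp only [h0, h1]
  ring

theorem eval_zero_of_isHomogeneous {σ : Type*} {F : MvPolynomial σ ℂ} {n : ℕ}
    (hF : F.IsHomogeneous n) (hn : n ≠ 0) : eval 0 F = 0 := by
  have h := eval_smul_of_isHomogeneous hF 0 0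
  rwa [smul_zero, zero_pow hn, zero_mul] at h

theorem eval_pderiv_extend_eq_zero {F : Binary} {n : ℕ} (hF : F.IsHomogeneous n) (hn : 2 ≤ n)
    {v : Fin 3 → ℂ} (hv : trunc v = 0) (j : Fin 3) : eval v (pderiv j (extend F)) = 0 := by
  rcases fin_three_cases j with rfl | rfl | rfl
  · rw [pderiv_zero_extend, eval_extend, hv]
    exact eval_zero_of_isHomogeneous hF.pderiv (by omega)
  · rw [pderiv_one_extend, eval_extend, hv]
    exact eval_zero_of_isHomogeneous hF.pderiv (by omega)
  · rw [pderiv_two_extend, map_zero]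

theorem trunc_ne_zero {v : Fin 3 → ℂ} (hv : v ≠ 0) (h2 : v 2 = 0) : trunc v ≠ 0 := by
  intro h
  apply hv
  funext i; fin_cases i
  · exact congrFun h 0
  · exact congrFun h 1
  · exact h2

/-- A singularity off `z = 0` can only be `(0:0:1)`, where all first derivatives of the form vanish
as `d ≥ 2`. On `z = 0` the multiplicity is one because `∂_z(zA) = A` and `∂_z(zB) = B` do not vanish
together, and the tangency order with a transverse line is the order of `fixForm`. -/
theorem isRadial_affineForm_iff {A B : Binary} {d : ℕ} (hd : 2 ≤ d) (hA : A.IsHomogeneous d)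
    (hB : B.IsHomogeneous d) (hAB : IsRelPrime A B) {v : Fin 3 → ℂ} (hv : v ≠ 0) (k : ℕ) :
    IsRadial (affineForm A B) v k ↔ 1 ≤ k ∧ v 2 = 0 ∧ HasOrder A B (trunc v) k := by
  constructor
  · rintro ⟨hk, hsing, ⟨i, j, hij⟩, hall, w, hw⟩
    have hv2 : v 2 = 0 := by
      by_contra hv2
      have s0 := hsing 0
      have s1 := hsing 1
      rw [formOf_affineForm_zero] at s0
      rw [formOf_affineForm_one] at s1
      rw [map_mul, eval_X, eval_extend, mul_eq_zero, or_iff_right hv2] at s0 s1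
      have ht : trunc v = 0 := by
        by_contra ht
        exact no_common_zero_of_isRelPrime hA hB hAB ht s0 s1
      have hdA := eval_pderiv_extend_eq_zero hA hd ht j
      have hdB := eval_pderiv_extend_eq_zero hB hd ht j
      have hdC := eval_pderiv_extend_eq_zero (isHomogeneous_fixedPoints hA hB) (by omega) ht j
      apply hij
      rcases fin_three_cases i with rfl | rfl | rfl
      · rw [formOf_affineForm_zero]
        simp only [Derivation.leibniz, smul_eq_mul, map_add, map_mul, hdA, eval_extend, s0]
        simp
      · rw [formOf_affineForm_one]
        simp only [Derivation.leibniz, smul_eq_mul, map_add, map_mul, hdB, eval_extend, s1]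
        simp
      · rw [formOf_affineForm_two, map_neg, map_neg, hdC, neg_zero]
    refine ⟨hk, hv2, ?_, ?_⟩
    · obtain ⟨u, hu⟩ := exists_wedge_ne_zero (trunc_ne_zero hv hv2)
      -- The third coordinate `1` keeps the line off infinity, and `u` is transverse to `v`.
      have h := hall ![u 0, u 1, 1]
      have ht : trunc ![u 0, u 1, 1] = u := by
        funext i; fin_cases i <;> rfl
      rw [lineRestriction_affineForm A B hv2, dvd_neg, ht] at h
      rw [lineThrough_pow_dvd_iff hu _ (isHomogeneous_fixForm hA hB _)]
      simpa using h
    · intro h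
      apply hw
      rw [lineRestriction_affineForm A B hv2, dvd_neg]
      exact Dvd.dvd.mul_left (X_pow_dvd_along_of_dvd _ h) _
  · rintro ⟨hk, hv2, h1, h2⟩
    have hF : eval (trunc v) (fixForm A B (trunc v)) = 0 :=
      eval_eq_zero_of_lineThrough_dvd ((dvd_pow_self _ (by omega)).trans h1)
    refine ⟨hk, ?_, ?_, ?_, ?_⟩
    · intro i
      rcases fin_three_cases i with rfl | rfl | rfl
      · rw [formOf_affineForm_zero, map_mul, eval_X, hv2, zero_mul]
      · rw [formOf_affineForm_one, map_mul, eval_X, hv2, zero_mul]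
      · rw [formOf_affineForm_two, map_neg, eval_extend, ← eval_fixForm_self, hF, neg_zero]
    · have hd2 : ∀ F : Binary, eval v (pderiv 2 (X 2 * extend F)) = eval (trunc v) F := by
        intro F
        rw [Derivation.leibniz, pderiv_two_extend, pderiv_X_self]
        simp only [smul_eq_mul, mul_one, mul_zero, zero_add]
        exact eval_extend v F
      by_cases hA0 : eval (trunc v) A = 0
      · refine ⟨1, 2, ?_⟩
        rw [formOf_affineForm_one, hd2]
        exact no_common_zero_of_isRelPrime hA hB hAB (trunc_ne_zero hv hv2) hA0
      · refine ⟨0, 2, ?_⟩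
        rwa [formOf_affineForm_zero, hd2]
    · intro w
      rw [lineRestriction_affineForm A B hv2, dvd_neg]
      exact Dvd.dvd.mul_left (X_pow_dvd_along_of_dvd _ h1) _
    · obtain ⟨u, hu⟩ := exists_wedge_ne_zero (trunc_ne_zero hv hv2)
      refine ⟨![u 0, u 1, 1], fun h => h2 ?_⟩
      have ht : trunc ![u 0, u 1, 1] = u := by
        funext i; fin_cases i <;> rfl
      rw [lineRestriction_affineForm A B hv2, dvd_neg, ht] at h
      rw [lineThrough_pow_dvd_iff hu _ (isHomogeneous_fixForm hA hB _)]
      simpa using h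

/-! ## Behaviour under linear conjugacy -/

open scoped Matrix

theorem eval_linSubst (M : Matrix (Fin 3) (Fin 3) ℂ) (v : Fin 3 → ℂ)
    (f : MvPolynomial (Fin 3) ℂ) : eval v (linSubst M f) = eval (M *ᵥ v) f := by
  have h : (eval v).comp (linSubst M).toRingHom = eval (M *ᵥ v) := by
    apply MvPolynomial.ringHom_ext
    · intro r
      simp [linSubst]
    · intro i
      simp [linSubst_X, Matrix.mulVec, dotProduct]
  exact DFunLike.congr_fun h f

theorem along_linSubst (M : Matrix (Fin 3) (Fin 3) ℂ) (v w : Fin 3 → ℂ)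
    (f : MvPolynomial (Fin 3) ℂ) : along v w (linSubst M f) = along (M *ᵥ v) (M *ᵥ w) f := by
  have h : (along v w).comp (linSubst M) = along (M *ᵥ v) (M *ᵥ w) := by
    apply MvPolynomial.algHom_ext
    intro i
    simp only [AlgHom.comp_apply, linSubst_X, along_X, map_mul, along_C, Matrix.mulVec,
      dotProduct, Fin.sum_univ_three, map_add]
    ring
  exact DFunLike.congr_fun h f

theorem pderiv_linSubst (M : Matrix (Fin 3) (Fin 3) ℂ) (j : Fin 3)
    (f : MvPolynomial (Fin 3) ℂ) :
    pderiv j (linSubst M f) = ∑ k, C (M k j) * linSubst M (pderiv k f) := by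
  induction f using MvPolynomial.induction_on with
  | C a => simp
  | add p q hp hq => simp only [map_add, hp, hq, mul_add, Finset.sum_add_distrib]
  | mul_X p i hp =>
    have hX : pderiv j (linSubst M (X i)) = C (M i j) := by
      rw [linSubst_X, map_sum]
      simp [pderiv_X, Pi.single_apply]
    have hX' : ∀ k, linSubst M (pderiv k (X i)) = if k = i then 1 else 0 := by
      intro k
      by_cases h : k = i
      · subst h; simp
      · simp [pderiv_X_of_ne (Ne.symm h), h]
    simp only [map_mul, Derivation.leibniz, smul_eq_mul, hp, hX, map_add, hX', mul_add,
      Finset.sum_add_distrib, Finset.mul_sum]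
    simp only [mul_ite, mul_one, mul_zero, Finset.sum_ite_eq', Finset.mem_univ, if_true]
    refine congrArg₂ (· + ·) (by ring) ?_
    refine Finset.sum_congr rfl fun k _ => ?_
    ring

/-- The 1-form of `W` is `c` times the pull-back by `M` of that of `V`. -/
def ConjBy (M : Matrix (Fin 3) (Fin 3) ℂ) (c : ℂ) (V W : Triple) : Prop :=
  formOf W = fun i => C c * pullback M (formOf V) i

theorem Conj.exists_conjBy {V W : Triple} (h : Conj V W) :
    ∃ M N : Matrix (Fin 3) (Fin 3) ℂ, ∃ c e : ℂ, M * N = 1 ∧ N * M = 1 ∧ c ≠ 0 ∧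
      ConjBy M c V W ∧ ConjBy N e W V := by
  obtain ⟨M, c, h⟩ := h
  refine ⟨M, (M⁻¹ : GL (Fin 3) ℂ), c, (c⁻¹ : ℂˣ), ?_, ?_, c.ne_zero, h, ?_⟩
  · rw [← Units.val_mul, mul_inv_cancel, Units.val_one]
  · rw [← Units.val_mul, inv_mul_cancel, Units.val_one]
  · rw [ConjBy, h, pullback_smul, ← pullback_mul, ← Units.val_mul, mul_inv_cancel, Units.val_one,
      pullback_one]
    funext i
    rw [← mul_assoc, ← C_mul, ← Units.val_mul, inv_mul_cancel, Units.val_one, C_1, one_mul]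

theorem ConjBy.eval_eq {M : Matrix (Fin 3) (Fin 3) ℂ} {c : ℂ} {V W : Triple}
    (h : ConjBy M c V W) (v : Fin 3 → ℂ) (i : Fin 3) :
    eval v (formOf W i) = c * ∑ j, M j i * eval (M *ᵥ v) (formOf V j) := by
  rw [h]
  simp only [pullback, map_mul, map_sum, eval_C, eval_linSubst]

theorem ConjBy.eval_pderiv_eq {M : Matrix (Fin 3) (Fin 3) ℂ} {c : ℂ} {V W : Triple}
    (h : ConjBy M c V W) (v : Fin 3 → ℂ) (i k : Fin 3) :
    eval v (pderiv k (formOf W i)) =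
      c * ∑ j, M j i * ∑ l, M l k * eval (M *ᵥ v) (pderiv l (formOf V j)) := by
  rw [h]
  simp only [pullback, pderiv_C_mul, map_sum, map_mul, eval_C, pderiv_linSubst, eval_linSubst]

theorem ConjBy.lineRestriction_eq {M : Matrix (Fin 3) (Fin 3) ℂ} {c : ℂ} {V W : Triple}
    (h : ConjBy M c V W) (v w : Fin 3 → ℂ) :
    lineRestriction W v w = Polynomial.C c * lineRestriction V (M *ᵥ v) (M *ᵥ w) := by
  rw [ConvexFol.lineRestriction_eq, ConvexFol.lineRestriction_eq, h]
  simp only [pullback, map_mul, along_C, along_linSubst, Fin.sum_univ_three,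
    Matrix.mulVec, dotProduct, map_add]
  ring

/-- Vanishing is transported by `M`; the two non-vanishing conditions need the inverse conjugacy, by
contraposition. -/
theorem isRadial_of_conjBy {M N : Matrix (Fin 3) (Fin 3) ℂ} {c e : ℂ} {V W : Triple}
    (hNM : N * M = 1) (h : ConjBy M c V W) (h' : ConjBy N e W V) {v : Fin 3 → ℂ} {k : ℕ}
    (hv : IsRadial V (M *ᵥ v) k) : IsRadial W v k := by
  have hNv : N *ᵥ (M *ᵥ v) = v := by rw [Matrix.mulVec_mulVec, hNM, Matrix.one_mulVec]
  obtain ⟨hk, hz, ⟨i, j, hij⟩, hall, w, hw⟩ := hv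
  refine ⟨hk, fun i => ?_, ?_, fun w => ?_, ?_⟩
  · rw [h.eval_eq]
    simp [hz]
  · by_contra! hcon
    apply hij
    rw [h'.eval_pderiv_eq, hNv]
    simp [hcon]
  · rw [h.lineRestriction_eq]
    exact (hall _).mul_left _
  · by_contra! hcon
    apply hw
    rw [h'.lineRestriction_eq, hNv]
    exact (hcon _).mul_left _

theorem isRadial_iff_of_conjBy {M N : Matrix (Fin 3) (Fin 3) ℂ} {c e : ℂ} {V W : Triple}
    (hMN : M * N = 1) (hNM : N * M = 1) (h : ConjBy M c V W) (h' : ConjBy N e W V)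
    (v : Fin 3 → ℂ) (k : ℕ) : IsRadial W v k ↔ IsRadial V (M *ᵥ v) k := by
  refine ⟨fun hv => ?_, isRadial_of_conjBy hNM h h'⟩
  refine isRadial_of_conjBy hMN h' h ?_
  rwa [Matrix.mulVec_mulVec, hNM, Matrix.one_mulVec]

/-! ### Transport of vector fields and of the inflection divisor -/

/-- The push-forward `M⁻¹ V(M p)` of a vector field, where `N = M⁻¹`. -/
def transport (M N : Matrix (Fin 3) (Fin 3) ℂ) (V : Triple) : Triple :=
  fun i => ∑ j, C (N i j) * linSubst M (V j)

theorem linSubst_eq_transport {M N : Matrix (Fin 3) (Fin 3) ℂ} (hMN : M * N = 1) (V : Triple)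
    (i : Fin 3) : linSubst M (V i) = ∑ j, C (M i j) * transport M N V j := by
  simp only [transport, Finset.mul_sum]
  rw [Finset.sum_comm]
  have : ∀ k, ∑ j, C (M i j) * (C (N j k) * linSubst M (V k)) =
      C ((M * N) i k) * linSubst M (V k) := by
    intro k
    simp only [Matrix.mul_apply, map_sum, C_mul, Finset.sum_mul, mul_assoc]
  simp only [this, hMN, Matrix.one_apply]
  simp

/-- This is the identity `Mᵀ (M a × M b) = det M (a × b)`. -/
theorem pullback_formOf {M N : Matrix (Fin 3) (Fin 3) ℂ} (hMN : M * N = 1) (V : Triple)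
    (i : Fin 3) : pullback M (formOf V) i = C M.det * formOf (transport M N V) i := by
  have hV := linSubst_eq_transport hMN V
  simp only [pullback, formOf_apply, Fin.sum_univ_three, Matrix.cons_val_zero, Matrix.cons_val_one,
    Matrix.cons_val, map_sub, map_mul, hV, linSubst_X, Matrix.det_fin_three, map_add]
  rcases fin_three_cases i with rfl | rfl | rfl
  all_goals
    simp only [Matrix.cons_val_zero, Matrix.cons_val_one, Matrix.cons_val]
    ring

theorem exists_eq_mul_X_of_formOf_eq_zero {Z : Triple} (h : formOf Z = 0) :
    ∃ g, ∀ i, Z i = g * X i := by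
  rw [formOf_apply] at h
  have h1 : X 2 * Z 0 - X 0 * Z 2 = 0 := congrFun h 1
  have h2 : X 0 * Z 1 - X 1 * Z 0 = 0 := congrFun h 2
  have hp := prime_X_fin (n := 3) 0
  have hd : X 0 ∣ Z 0 := by
    refine (hp.dvd_or_dvd (a := X 1) ⟨Z 1, by linear_combination -h2⟩).resolve_left fun h3 => ?_
    rw [X_dvd_X] at h3
    simp at h3
  obtain ⟨g, hg⟩ := hd
  refine ⟨g, fun i => ?_⟩
  rcases fin_three_cases i with rfl | rfl | rfl
  · rw [hg, mul_comm]
  · apply mul_left_cancel₀ hp.ne_zero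
    rw [hg] at h2
    linear_combination h2
  · apply mul_left_cancel₀ hp.ne_zero
    rw [hg] at h1
    linear_combination -h1

/-- The 1-form determines the field up to a multiple of the radial field. -/
theorem ConjBy.exists_eq_add {M N : Matrix (Fin 3) (Fin 3) ℂ} {c : ℂ} {V W : Triple}
    (hMN : M * N = 1) (h : ConjBy M c V W) :
    ∃ g, ∀ i, W i = C (c * M.det) * transport M N V i + g * X i := by
  obtain ⟨g, hg⟩ := exists_eq_mul_X_of_formOf_eq_zero
    (Z := fun i => W i - C (c * M.det) * transport M N V i) (by
      have h1 : ∀ i, formOf W i = C (c * M.det) * formOf (transport M N V) i := by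
        intro i
        rw [h, C_mul, mul_assoc, ← pullback_formOf hMN]
      have a0 := h1 0
      have a1 := h1 1
      have a2 := h1 2
      simp only [formOf_apply, Matrix.cons_val_zero, Matrix.cons_val_one, Matrix.cons_val]
        at a0 a1 a2
      rw [formOf_apply]
      funext i
      rcases fin_three_cases i with rfl | rfl | rfl
      · simp only [Matrix.cons_val_zero, Pi.zero_apply]; linear_combination a0
      · simp only [Matrix.cons_val_one, Matrix.cons_val_zero, Pi.zero_apply]; linear_combination a1
      · simp only [Matrix.cons_val, Pi.zero_apply]; linear_combination a2)
  exact ⟨g, fun i => by rw [← hg i]; ring⟩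

theorem isHomogeneous_linSubst {f : MvPolynomial (Fin 3) ℂ} {n : ℕ} (hf : f.IsHomogeneous n)
    (M : Matrix (Fin 3) (Fin 3) ℂ) : (linSubst M f).IsHomogeneous n := by
  have := hf.aeval (fun i => ∑ j, C (M i j) * X j) (n := 1)
    (fun i => IsHomogeneous.sum _ _ _ fun j _ => isHomogeneous_C_mul_X _ _)
  simpa [linSubst] using this

theorem isHomogeneous_transport {V : Triple} {d : ℕ} (hV : ∀ i, (V i).IsHomogeneous d)
    (M N : Matrix (Fin 3) (Fin 3) ℂ) (i : Fin 3) : (transport M N V i).IsHomogeneous d :=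
  IsHomogeneous.sum _ _ _ fun j _ => (isHomogeneous_linSubst (hV j) M).C_mul _

theorem lieD_add_mul_X {U W : Triple} {g : MvPolynomial (Fin 3) ℂ} {c : ℂ}
    (h : ∀ i, W i = C c * U i + g * X i) {f : MvPolynomial (Fin 3) ℂ} {n : ℕ}
    (hf : f.IsHomogeneous n) : lieD W f = C c * lieD U f + g * (n : MvPolynomial (Fin 3) ℂ) * f := by
  have hE := hf.sum_X_mul_pderiv
  simp only [Fin.sum_univ_three, nsmul_eq_mul] at hE
  simp only [lieD, Fin.sum_univ_three, h]
  linear_combination g * hE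

theorem lieD_add (V : Triple) (f g : MvPolynomial (Fin 3) ℂ) :
    lieD V (f + g) = lieD V f + lieD V g := by
  simp only [lieD, map_add, mul_add, Finset.sum_add_distrib]

theorem lieD_C_mul (V : Triple) (c : ℂ) (f : MvPolynomial (Fin 3) ℂ) :
    lieD V (C c * f) = C c * lieD V f := by
  simp only [lieD, pderiv_C_mul, Finset.mul_sum]
  refine Finset.sum_congr rfl fun i _ => ?_
  ring

/-- Adding `g` times the radial field changes the second and third rows of the determinant, up to
the factors `c` and `c²`, by combinations of the rows above them. -/
theorem inflection_add_mul_X {U W : Triple} {g : MvPolynomial (Fin 3) ℂ} {c : ℂ} {d : ℕ}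
    (hU : ∀ i, (U i).IsHomogeneous d) (h : ∀ i, W i = C c * U i + g * X i) :
    inflection W = C c ^ 3 * inflection U := by
  have h2 : ∀ i, lieD W (W i) = C c * (C c * lieD U (U i) + g * (d : MvPolynomial (Fin 3) ℂ) * U i) + (g * W i +
      X i * lieD W g) := by
    intro i
    rw [congrArg (lieD W) (h i), lieD_add, lieD_C_mul, lieD_mul, lieD_X, lieD_add_mul_X h (hU i)]
  simp only [inflection, Matrix.det_fin_three, Matrix.of_apply, Matrix.cons_val_zero,
    Matrix.cons_val_one, Matrix.cons_val, lieD_X, h2]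
  simp only [h]
  ring

theorem lieD_transport {M N : Matrix (Fin 3) (Fin 3) ℂ} (hMN : M * N = 1) (V : Triple)
    (f : MvPolynomial (Fin 3) ℂ) :
    lieD (transport M N V) (linSubst M f) = linSubst M (lieD V f) := by
  simp only [lieD, pderiv_linSubst, map_add, map_mul, linSubst_eq_transport hMN V,
    Fin.sum_univ_three]
  ring

theorem linSubst_inflection {M N : Matrix (Fin 3) (Fin 3) ℂ} (hMN : M * N = 1) (V : Triple) :
    linSubst M (inflection V) = C M.det * inflection (transport M N V) := by
  have h2 : ∀ i, linSubst M (lieD V (V i)) =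
      ∑ j, C (M i j) * lieD (transport M N V) (transport M N V j) := by
    intro i
    rw [← lieD_transport hMN, linSubst_eq_transport hMN]
    simp only [Fin.sum_univ_three, lieD_add, lieD_C_mul]
  simp only [inflection, Matrix.det_fin_three, Matrix.of_apply, Matrix.cons_val_zero,
    Matrix.cons_val_one, Matrix.cons_val, lieD_X, map_add, map_sub, map_mul, h2,
    linSubst_eq_transport hMN V, linSubst_X, Fin.sum_univ_three]
  ring

theorem linSubst_linSubst {M N : Matrix (Fin 3) (Fin 3) ℂ} (hMN : M * N = 1)
    (f : MvPolynomial (Fin 3) ℂ) : linSubst N (linSubst M f) = f := by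
  rw [← linSubst_mul, hMN, linSubst_one, AlgHom.id_apply]

/-- Lines in the inflection divisor of a foliation conjugate to a convex one are invariant. -/
theorem isInvariantCurve_of_conj {V W : Triple} (h : Conj V W) {d : ℕ}
    (hV : ∀ i, (V i).IsHomogeneous d) (hW : IsConvex W) {ℓ : MvPolynomial (Fin 3) ℂ}
    (hℓ : ℓ.IsHomogeneous 1) (hℓ0 : ℓ ≠ 0) (hd : ℓ ∣ inflection V) : IsInvariantCurve V ℓ := by
  obtain ⟨M, N, c, e, hMN, hNM, hc, hVW, -⟩ := h.exists_conjBy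
  have hdet : M.det ≠ 0 := by
    intro h0
    have := congrArg Matrix.det hMN
    rw [Matrix.det_mul, h0, zero_mul, Matrix.det_one] at this
    exact zero_ne_one this
  obtain ⟨g, hg⟩ := hVW.exists_eq_add hMN
  have hU := isHomogeneous_transport hV M N
  have hℓ' := isHomogeneous_linSubst hℓ M
  have hirr : Irreducible (linSubst M ℓ) := by
    refine irreducible_of_isHomogeneous_one hℓ' fun h0 => hℓ0 ?_
    rw [← linSubst_linSubst hMN ℓ, h0, map_zero]
  have hd' : linSubst M ℓ ∣ inflection W := by
    rw [inflection_add_mul_X hU hg]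
    refine Dvd.dvd.mul_left ?_ _
    rw [← (isUnit_C_of_ne_zero hdet).dvd_mul_left, ← linSubst_inflection hMN]
    exact map_dvd _ hd
  have hinv := hW _ hirr hd'
  rw [IsInvariantCurve, lieD_add_mul_X hg hℓ', dvd_add_left (Dvd.intro_left _ rfl),
    (isUnit_C_of_ne_zero (mul_ne_zero hc hdet)).dvd_mul_left, lieD_transport hMN] at hinv
  have := map_dvd (linSubst N) hinv
  rwa [linSubst_linSubst hMN, linSubst_linSubst hMN] at this

/-! ## Normalization of three critical points -/

/-- The vector with coordinates `v` in the basis `a`, `b`. -/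
def comb (a b v : Fin 2 → ℂ) : Fin 2 → ℂ := v 0 • a + v 1 • b

/-- The linear substitution `F ↦ F(x a + y b)`. -/
def binSubst (a b : Fin 2 → ℂ) : Binary →ₐ[ℂ] Binary :=
  aeval fun i => C (a i) * X 0 + C (b i) * X 1

theorem binSubst_X (a b : Fin 2 → ℂ) (i : Fin 2) :
    binSubst a b (X i) = C (a i) * X 0 + C (b i) * X 1 := aeval_X _ _

theorem binSubst_C (a b : Fin 2 → ℂ) (c : ℂ) : binSubst a b (C c) = C c := aeval_C _ _

theorem eval_binSubst (a b v : Fin 2 → ℂ) (F : Binary) :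
    eval v (binSubst a b F) = eval (comb a b v) F := by
  have h : (eval v).comp (binSubst a b).toRingHom = eval (comb a b v) := by
    apply MvPolynomial.ringHom_ext
    · intro r
      simp [binSubst]
    · intro i
      simp [binSubst, comb, mul_comm]
  exact DFunLike.congr_fun h F

theorem wedge_comb (a b v w : Fin 2 → ℂ) :
    wedge (comb a b v) (comb a b w) = wedge a b * wedge v w := by
  simp [wedge, comb]; ring

theorem binSubst_lineThrough (a b v : Fin 2 → ℂ) :
    binSubst a b (lineThrough (comb a b v)) = C (wedge a b) * lineThrough v := by
  simp only [lineThrough, map_sub, map_mul, binSubst_X, binSubst_C, wedge, comb, Pi.add_apply,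
    Pi.smul_apply, smul_eq_mul, map_add]
  ring

theorem isHomogeneous_binSubst (a b : Fin 2 → ℂ) {F : Binary} {n : ℕ} (hF : F.IsHomogeneous n) :
    (binSubst a b F).IsHomogeneous n := by
  have := hF.aeval (fun i => (C (a i) * X 0 + C (b i) * X 1 : Binary)) (n := 1)
    (fun i => (isHomogeneous_C_mul_X _ _).add (isHomogeneous_C_mul_X _ _))
  simpa [binSubst] using this

/-- The pull-back of `A dx + B dy` by `x a + y b` has as coefficients the substituted `fixForm A B
a` and `fixForm A B b`. -/
theorem fixForm_binSubst (A B : Binary) (a b v : Fin 2 → ℂ) :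
    fixForm (binSubst a b (fixForm A B a)) (binSubst a b (fixForm A B b)) v =
      binSubst a b (fixForm A B (comb a b v)) := by
  simp only [fixForm, map_add, map_mul, binSubst_C, comb, Pi.add_apply, Pi.smul_apply, smul_eq_mul]
  ring

theorem extend_C (c : ℂ) : extend (C c) = C c := rename_C _ _

theorem conj_affineForm_binSubst (A B : Binary) {a b : Fin 2 → ℂ} (hab : wedge a b ≠ 0) :
    Conj (affineForm A B)
      (affineForm (binSubst a b (fixForm A B a)) (binSubst a b (fixForm A B b))) := by
  -- The plane substitution, extended by fixing `z`.
  set M : Matrix (Fin 3) (Fin 3) ℂ := !![a 0, b 0, 0; a 1, b 1, 0; 0, 0, 1] with hM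
  have hdet : M.det ≠ 0 := by
    rw [hM, Matrix.det_fin_three]
    simp only [wedge] at hab
    simpa [mul_comm (b 0)] using hab
  have hsub : ∀ F, linSubst M (extend F) = extend (binSubst a b F) := by
    intro F
    have : (linSubst M).comp extend = extend.comp (binSubst a b) := by
      apply MvPolynomial.algHom_ext
      intro i
      rw [AlgHom.comp_apply, AlgHom.comp_apply, rename_X, linSubst_X, binSubst_X, map_add, map_mul,
        map_mul, extend_X_zero, extend_X_one, extend_C, extend_C, Fin.sum_univ_three]
      fin_cases i <;> simp [hM]
    exact DFunLike.congr_fun this F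
  have hX2 : linSubst M (X 2) = X 2 := by
    rw [linSubst_X, Fin.sum_univ_three]; simp [hM]
  refine ⟨Matrix.GeneralLinearGroup.mkOfDetNeZero M hdet, 1, ?_⟩
  have hcoe : ((Matrix.GeneralLinearGroup.mkOfDetNeZero M hdet : GL (Fin 3) ℂ) :
      Matrix (Fin 3) (Fin 3) ℂ) = M := rfl
  rw [hcoe]
  funext i
  simp only [pullback, Fin.sum_univ_three, formOf_affineForm_zero, formOf_affineForm_one,
    formOf_affineForm_two, map_mul, map_neg, hsub, hX2, Units.val_one, C_1, one_mul]
  rcases fin_three_cases i with rfl | rfl | rfl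
  · simp only [formOf_affineForm_zero, fixForm, map_add, map_mul, binSubst_C, extend_C]
    simp [hM]; ring
  · simp only [formOf_affineForm_one, fixForm, map_add, map_mul, binSubst_C, extend_C]
    simp [hM]; ring
  · simp only [formOf_affineForm_two, fixForm, map_add, map_mul, binSubst_C, binSubst_X, extend_C,
      extend_X_zero, extend_X_one]
    simp [hM]; ring

theorem conj_affineForm_C_mul (A B : Binary) {c : ℂ} (hc : c ≠ 0) :
    Conj (affineForm A B) (affineForm (C c * A) (C c * B)) := by
  refine ⟨1, Units.mk0 c hc, ?_⟩
  rw [Units.val_one, pullback_one]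
  funext i
  rw [Units.val_mk0]
  rcases fin_three_cases i with rfl | rfl | rfl
  · simp only [formOf_affineForm_zero, map_mul, extend_C]; ring
  · simp only [formOf_affineForm_one, map_mul, extend_C]; ring
  · simp only [formOf_affineForm_two, map_mul, map_add, extend_C]; ring

theorem lineThrough_smul (a : ℂ) (v : Fin 2 → ℂ) : lineThrough (a • v) = C a * lineThrough v := by
  simp only [lineThrough, Pi.smul_apply, smul_eq_mul, C_mul]; ring

theorem fixForm_smul (A B : Binary) (a : ℂ) (v : Fin 2 → ℂ) :
    fixForm A B (a • v) = C a * fixForm A B v := by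
  simp only [fixForm, Pi.smul_apply, smul_eq_mul, C_mul]; ring

theorem lineThrough_smul_pow_dvd_iff (A B : Binary) {a : ℂ} (ha : a ≠ 0) (v : Fin 2 → ℂ) (n : ℕ) :
    lineThrough (a • v) ^ n ∣ fixForm A B (a • v) ↔ lineThrough v ^ n ∣ fixForm A B v := by
  have hu : IsUnit (C a : Binary) := isUnit_C_of_ne_zero ha
  rw [lineThrough_smul, fixForm_smul, mul_pow, hu.dvd_mul_left, (hu.pow n).mul_left_dvd]

theorem hasOrder_smul_iff (A B : Binary) {a : ℂ} (ha : a ≠ 0) (v : Fin 2 → ℂ) (k : ℕ) :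
    HasOrder A B (a • v) k ↔ HasOrder A B v k := by
  rw [HasOrder, HasOrder, lineThrough_smul_pow_dvd_iff A B ha, lineThrough_smul_pow_dvd_iff A B ha]

theorem eval_eq_zero_of_fixForm {A B : Binary} {v w u : Fin 2 → ℂ} (h : wedge v w ≠ 0)
    (hv : eval u (fixForm A B v) = 0) (hw : eval u (fixForm A B w) = 0) :
    eval u A = 0 ∧ eval u B = 0 := by
  simp only [fixForm, map_add, map_mul, eval_C] at hv hw
  have hA0 : wedge v w * eval u A = 0 := by
    simp only [wedge]; linear_combination w 1 * hv - v 1 * hw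
  have hB0 : wedge v w * eval u B = 0 := by
    simp only [wedge]; linear_combination v 0 * hw - w 0 * hv
  exact ⟨by simpa [h] using hA0, by simpa [h] using hB0⟩

theorem isRelPrime_of_no_common_zero' {A B : Binary} {d : ℕ} (hd : d ≠ 0) (hA : A.IsHomogeneous d)
    (hB : B.IsHomogeneous d) (h : ∀ v : Fin 2 → ℂ, v ≠ 0 → eval v A = 0 → eval v B ≠ 0) :
    IsRelPrime A B := by
  refine isRelPrime_of_no_common_zero hA ?_ h
  rintro rfl
  obtain ⟨e, rfl⟩ := Nat.exists_eq_succ_of_ne_zero hd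
  obtain ⟨v, hv, hv0⟩ := exists_zero_of_isHomogeneous hB
  exact h v hv (map_zero _) hv0

theorem comb_ne_zero {a b v : Fin 2 → ℂ} (hab : wedge a b ≠ 0) (hv : v ≠ 0) : comb a b v ≠ 0 := by
  obtain ⟨w, hw⟩ := exists_wedge_ne_zero hv
  refine wedge_ne_zero_left (w := comb a b w) ?_
  rw [wedge_comb]
  exact mul_ne_zero hab hw

theorem ThreeCritical.degree_ge {d : ℕ} {A B : Binary} {p : Fin 3 → Fin 2 → ℂ} {k : Fin 3 → ℕ}
    (h : ThreeCritical d A B p k) : 3 ≤ d := by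
  have := h.sum
  rw [Fin.sum_univ_three] at this
  have := h.pos 0; have := h.pos 1; have := h.pos 2
  omega

/-- Rescale `p 0` and `p 1` so that they add up to `p 2`; in this basis the critical points are the
standard ones, and rigidity identifies the two maps. -/
theorem ThreeCritical.conj {d : ℕ} {A B A₀ B₀ : Binary} {p : Fin 3 → Fin 2 → ℂ} {k : Fin 3 → ℕ}
    (h : ThreeCritical d A B p k) (h₀ : ThreeCritical d A₀ B₀ stdPoint k) :
    Conj (affineForm A₀ B₀) (affineForm A B) := by
  have hd : d ≠ 0 := by have := h.degree_ge; omega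
  have h01 := h.indep 0 1 (by decide)
  -- Cramer's rule for `p 2` in the basis `p 0`, `p 1`.
  set α := wedge (p 2) (p 1) / wedge (p 0) (p 1)
  set β := wedge (p 0) (p 2) / wedge (p 0) (p 1)
  have hα : α ≠ 0 := div_ne_zero (h.indep 2 1 (by decide)) h01
  have hβ : β ≠ 0 := div_ne_zero (h.indep 0 2 (by decide)) h01
  have hsum : α • p 0 + β • p 1 = p 2 := by
    have h' := h01
    simp only [wedge] at h'
    funext j
    simp only [Pi.add_apply, Pi.smul_apply, smul_eq_mul, α, β, wedge]
    rw [div_mul_eq_mul_div, div_mul_eq_mul_div, ← add_div, div_eq_iff h']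
    fin_cases j <;> simp only [Fin.zero_eta, Fin.mk_one] <;> ring
  have hab : wedge (α • p 0) (β • p 1) ≠ 0 := by
    have : wedge (α • p 0) (β • p 1) = α * β * wedge (p 0) (p 1) := by
      simp [wedge]; ring
    rw [this]
    exact mul_ne_zero (mul_ne_zero hα hβ) h01
  set a := α • p 0
  set b := β • p 1
  have hcomb : ∀ i, ∃ c : ℂ, c ≠ 0 ∧ comb a b (stdPoint i) = c • p i := by
    intro i
    rcases fin_three_cases i with rfl | rfl | rfl
    · exact ⟨α, hα, by simp [comb, stdPoint, a]⟩
    · exact ⟨β, hβ, by simp [comb, stdPoint, b]⟩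
    · exact ⟨1, one_ne_zero, by simp [comb, stdPoint, hsum]⟩
  have hFa := isHomogeneous_binSubst a b (isHomogeneous_fixForm h.homA h.homB a)
  have hFb := isHomogeneous_binSubst a b (isHomogeneous_fixForm h.homA h.homB b)
  have hrel : IsRelPrime (binSubst a b (fixForm A B a)) (binSubst a b (fixForm A B b)) := by
    refine isRelPrime_of_no_common_zero' hd hFa hFb fun v hv h1 h2 => ?_
    rw [eval_binSubst] at h1 h2
    obtain ⟨hA0, hB0⟩ := eval_eq_zero_of_fixForm hab h1 h2
    exact no_common_zero_of_isRelPrime h.homA h.homB h.relPrime (comb_ne_zero hab hv) hA0 hB0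
  have hdvd : ∀ i, lineThrough (stdPoint i) ^ (k i + 1) ∣
      fixForm (binSubst a b (fixForm A B a)) (binSubst a b (fixForm A B b)) (stdPoint i) := by
    intro i
    obtain ⟨c, hc, hci⟩ := hcomb i
    have h1 := (lineThrough_smul_pow_dvd_iff A B hc (p i) (k i + 1)).2 (h.order i).1
    rw [← hci] at h1
    have h2 := map_dvd (binSubst a b) h1
    rw [map_pow, binSubst_lineThrough, mul_pow] at h2
    rw [fixForm_binSubst]
    exact (((isUnit_C_of_ne_zero hab).pow _).mul_left_dvd).1 h2
  obtain ⟨c, hc, hcA, hcB⟩ := proportional_of_fixForm_dvd hd h₀.homA h₀.homB h₀.relPrime hFa hFb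
    hrel wedge_stdPoint (fun i => (h₀.order i).1) hdvd h.sum.ge
  have h1 := conj_affineForm_C_mul A₀ B₀ hc
  rw [← hcA, ← hcB] at h1
  exact conj_equivalence.trans h1 (conj_equivalence.symm (conj_affineForm_binSubst A B hab))

/-! ## Radial singularities and types -/

theorem HasOrder.unique {A B : Binary} {v : Fin 2 → ℂ} {k n : ℕ} (hk : HasOrder A B v k)
    (hn : HasOrder A B v n) : k = n := by
  rcases lt_trichotomy k n with h | h | h
  · exact absurd ((pow_dvd_pow _ (by omega)).trans hn.1) hk.2
  · exact h
  · exact absurd ((pow_dvd_pow _ (by omega)).trans hk.1) hn.2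

theorem HasOrder.lt_degree {A B : Binary} {d : ℕ} (hA : A.IsHomogeneous d) (hB : B.IsHomogeneous d)
    {v : Fin 2 → ℂ} {k : ℕ} (h : HasOrder A B v k) : k < d := by
  have hF : fixForm A B v ≠ 0 := fun h0 => h.2 (h0 ▸ dvd_zero _)
  obtain ⟨j, E, hj, -⟩ := exists_eq_mul_of_dvd (isHomogeneous_lineThrough_pow v (k + 1))
    (isHomogeneous_fixForm hA hB v) hF h.1
  omega

/-- A vector of the plane as a point at infinity. -/
def atInfinity (v : Fin 2 → ℂ) : Fin 3 → ℂ := ![v 0, v 1, 0]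

theorem trunc_atInfinity (v : Fin 2 → ℂ) : trunc (atInfinity v) = v := by
  funext i; fin_cases i <;> rfl

theorem atInfinity_trunc {v : Fin 3 → ℂ} (hv : v 2 = 0) : atInfinity (trunc v) = v := by
  funext i
  rcases fin_three_cases i with rfl | rfl | rfl
  · rfl
  · rfl
  · exact hv.symm

theorem atInfinity_smul (a : ℂ) (v : Fin 2 → ℂ) : atInfinity (a • v) = a • atInfinity v := by
  funext i; fin_cases i <;> simp [atInfinity]

theorem trunc_smul (a : ℂ) (v : Fin 3 → ℂ) : trunc (a • v) = a • trunc v := rfl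

theorem atInfinity_ne_zero {v : Fin 2 → ℂ} (hv : v ≠ 0) : atInfinity v ≠ 0 := by
  intro h
  apply hv
  rw [← trunc_atInfinity v, h]; rfl

theorem mulVec_ne_zero {M N : Matrix (Fin 3) (Fin 3) ℂ} (hNM : N * M = 1) {v : Fin 3 → ℂ}
    (hv : v ≠ 0) : M *ᵥ v ≠ 0 := by
  intro h
  apply hv
  rw [← Matrix.one_mulVec v, ← hNM, ← Matrix.mulVec_mulVec, h, Matrix.mulVec_zero]

/-- Each linear factor of `F` accounts for at most one projective point. This finiteness lets
`ncard` count the radial singularities faithfully. -/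
theorem finite_setOf_root {M N : Matrix (Fin 3) (Fin 3) ℂ} (hNM : N * M = 1) {F : Binary} {n : ℕ}
    (hF : F.IsHomogeneous n) (hF0 : F ≠ 0) :
    {s : Projectivization ℂ (Fin 3 → ℂ) |
      (M *ᵥ s.rep) 2 = 0 ∧ eval (trunc (M *ᵥ s.rep)) F = 0}.Finite := by
  induction n generalizing F with
  | zero =>
    rw [← totalDegree_zero_iff_isHomogeneous, totalDegree_eq_zero_iff_eq_C] at hF
    convert Set.finite_empty
    ext s
    simp only [Set.mem_empty_iff_false, iff_false]
    rintro ⟨-, h⟩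
    rw [hF, eval_C] at h
    rw [h, C_0] at hF
    exact hF0 hF
  | succ n ih =>
    obtain ⟨v, hv, hv0⟩ := exists_zero_of_isHomogeneous hF
    obtain ⟨j, E, hj, hE, hE0, rfl⟩ := exists_eq_mul_of_dvd (isHomogeneous_lineThrough v) hF hF0
      (lineThrough_dvd_of_eval_eq_zero hF hv hv0)
    obtain rfl : j = n := by omega
    have hline : {s : Projectivization ℂ (Fin 3 → ℂ) | (M *ᵥ s.rep) 2 = 0 ∧
        eval (trunc (M *ᵥ s.rep)) (lineThrough v) = 0}.Subsingleton := by
      rintro s ⟨hs, hs0⟩ t ⟨ht, ht0⟩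
      rw [eval_lineThrough, neg_eq_zero, wedge_comm, neg_eq_zero] at hs0 ht0
      have hns := trunc_ne_zero (mulVec_ne_zero hNM s.rep_nonzero) hs
      have hnt := trunc_ne_zero (mulVec_ne_zero hNM t.rep_nonzero) ht
      obtain ⟨a, ha⟩ := exists_smul_of_wedge_eq_zero hns hs0
      obtain ⟨b, hb⟩ := exists_smul_of_wedge_eq_zero hnt ht0
      have hb0 : b ≠ 0 := by
        rintro rfl
        rw [zero_smul] at hb
        exact hv hb
      have ha0 : a ≠ 0 := by
        rintro rfl
        rw [zero_smul] at ha
        exact hv ha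
      have h1 : a • (M *ᵥ s.rep) = b • (M *ᵥ t.rep) := by
        rw [← atInfinity_trunc hs, ← atInfinity_trunc ht, ← atInfinity_smul, ← atInfinity_smul,
          ← ha, ← hb]
      have h2 : a • s.rep = b • t.rep := by
        have := congrArg (N *ᵥ ·) h1
        simpa [Matrix.mulVec_smul, Matrix.mulVec_mulVec, hNM] using this
      rw [← s.mk_rep, ← t.mk_rep, Projectivization.mk_eq_mk_iff']
      exact ⟨a⁻¹ * b, by rw [mul_smul, ← h2, smul_smul, inv_mul_cancel₀ ha0, one_smul]⟩
    refine (hline.finite.union (ih hE hE0)).subset ?_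
    rintro s ⟨hs, hs0⟩
    rw [map_mul, mul_eq_zero] at hs0
    rcases hs0 with h | h
    · exact Or.inl ⟨hs, h⟩
    · exact Or.inr ⟨hs, h⟩

theorem HasOrder.eval_jac_eq_zero {A B : Binary} {v : Fin 2 → ℂ} (hv : v ≠ 0) {k : ℕ} (hk : 1 ≤ k)
    (h : HasOrder A B v k) : eval v (jac A B) = 0 :=
  eval_eq_zero_of_lineThrough_dvd
    ((dvd_pow_self _ (by omega)).trans (lineThrough_pow_dvd_jac hv h.1))

theorem ThreeCritical.jac_ne_zero {d : ℕ} {A B : Binary} {p : Fin 3 → Fin 2 → ℂ} {k : Fin 3 → ℕ}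
    (h : ThreeCritical d A B p k) : jac A B ≠ 0 := by
  have hne := ne_zero_of_indep h.indep 0
  intro h0
  refine not_lineThrough_pow_succ_dvd_jac ?_ h.homA h.homB hne
    (no_common_zero_of_isRelPrime h.homA h.homB h.relPrime hne) (h.order 0) (h0 ▸ dvd_zero _)
  have := h.degree_ge
  omega

/-- A radial singularity lies over a root of the Jacobian, hence over some `p i`, where its order
must be `k i`. Stated for any conjugate field, it gives the types and also the inequivalence of the
normal forms. -/
theorem radialCount_of_conj {d : ℕ} {A B : Binary} {p : Fin 3 → Fin 2 → ℂ} {k : Fin 3 → ℕ}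
    (h : ThreeCritical d A B p k) {W : Triple} (hW : Conj (affineForm A B) W) (n : ℕ) :
    radialCount W n = ∑ i, if k i = n then 1 else 0 := by
  obtain ⟨M, N, c, e, hMN, hNM, -, h1, h2⟩ := hW.exists_conjBy
  have hne := ne_zero_of_indep h.indep
  have hd := h.degree_ge
  have hrad : ∀ s : Projectivization ℂ (Fin 3 → ℂ), IsRadial W s.rep n ↔
      1 ≤ n ∧ (M *ᵥ s.rep) 2 = 0 ∧ HasOrder A B (trunc (M *ᵥ s.rep)) n := by
    intro s
    rw [isRadial_iff_of_conjBy hMN hNM h1 h2,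
      isRadial_affineForm_iff (by omega) h.homA h.homB h.relPrime (mulVec_ne_zero hNM s.rep_nonzero)]
  have hq : ∀ i, N *ᵥ atInfinity (p i) ≠ 0 := fun i =>
    mulVec_ne_zero hMN (atInfinity_ne_zero (hne i))
  set q : Fin 3 → Projectivization ℂ (Fin 3 → ℂ) := fun i => Projectivization.mk ℂ _ (hq i)
  have hqrep : ∀ i, ∃ a : ℂ, a ≠ 0 ∧ M *ᵥ (q i).rep = atInfinity (a • p i) := by
    intro i
    obtain ⟨a, ha⟩ := Projectivization.exists_smul_eq_mk_rep ℂ _ (hq i)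
    refine ⟨a, a.ne_zero, ?_⟩
    rw [← ha, Units.smul_def, Matrix.mulVec_smul, Matrix.mulVec_mulVec, hMN, Matrix.one_mulVec,
      atInfinity_smul]
  have hinj : Function.Injective q := by
    intro i j hij
    by_contra hne'
    apply h.indep i j hne'
    obtain ⟨a, ha⟩ := (Projectivization.mk_eq_mk_iff' _ _ _ _ _).1 hij
    rw [← Matrix.mulVec_smul] at ha
    have h3 := congrArg (fun v => trunc (M *ᵥ v)) ha
    simp only [Matrix.mulVec_mulVec, hMN, Matrix.one_mulVec, trunc_smul, trunc_atInfinity] at h3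
    rw [← h3, wedge_comm, wedge_smul_right, wedge_self, mul_zero, neg_zero]
  have hset : {s : Projectivization ℂ (Fin 3 → ℂ) | IsRadial W s.rep n} =
      q '' {i | k i = n} := by
    ext s
    constructor
    · intro hs
      obtain ⟨hn, hs2, hs⟩ := (hrad s).1 hs
      have hu := trunc_ne_zero (mulVec_ne_zero hNM s.rep_nonzero) hs2
      obtain ⟨i, hi⟩ := h.root _ hu (hs.eval_jac_eq_zero hu hn)
      obtain ⟨a, ha⟩ := exists_smul_of_wedge_eq_zero (hne i) hi
      have ha0 : a ≠ 0 := by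
        rintro rfl
        rw [zero_smul] at ha
        exact hu ha
      rw [ha, hasOrder_smul_iff A B ha0] at hs
      refine ⟨i, (h.order i).unique hs, ?_⟩
      rw [← s.mk_rep, Projectivization.mk_eq_mk_iff']
      refine ⟨a⁻¹, ?_⟩
      have h3 : s.rep = N *ᵥ (M *ᵥ s.rep) := by
        rw [Matrix.mulVec_mulVec, hNM, Matrix.one_mulVec]
      rw [h3, ← atInfinity_trunc hs2, ha, atInfinity_smul, Matrix.mulVec_smul, smul_smul,
        inv_mul_cancel₀ ha0, one_smul]
    · rintro ⟨i, hi, rfl⟩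
      obtain ⟨a, ha0, ha⟩ := hqrep i
      refine (hrad _).2 ?_
      rw [ha, trunc_atInfinity, hasOrder_smul_iff A B ha0]
      have hi' : k i = n := hi
      exact ⟨hi' ▸ h.pos i, rfl, hi' ▸ h.order i⟩
  rw [radialCount, hset, Set.ncard_image_of_injective _ hinj, Finset.sum_boole, Nat.cast_id,
    ← Set.ncard_coe_finset]
  simp

/-! ### The type of a convex foliation -/

theorem isHomogeneous_linForm (a : Fin 3 → ℂ) : (linForm a).IsHomogeneous 1 :=
  IsHomogeneous.sum _ _ _ fun _ _ => isHomogeneous_C_mul_X _ _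

theorem linForm_ne_zero {a : Fin 3 → ℂ} (ha : a ≠ 0) : linForm a ≠ 0 := by
  intro h
  apply ha
  funext i
  have h1 := congrArg (eval (Pi.single i 1)) h
  simpa [linForm, Pi.single_apply] using h1

theorem transverseCount_of_isConvex {V : Triple} (hV : IsConvex V) {k : ℕ} (hk : 1 ≤ k) :
    transverseCount V k = 0 := by
  rw [transverseCount, ← Set.ncard_empty (Projectivization ℂ (Fin 3 → ℂ))]
  refine congrArg Set.ncard (Set.eq_empty_of_forall_notMem fun a => ?_)
  rintro ⟨hninv, hmul⟩
  apply hninv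
  refine hV _ (irreducible_of_isHomogeneous_one (isHomogeneous_linForm _)
    (linForm_ne_zero a.rep_nonzero)) ?_
  have h1 : linForm a.rep ^ k ∣ inflection V := pow_dvd_of_le_emultiplicity hmul.ge
  exact (dvd_pow_self _ (by omega)).trans h1

theorem typeDegree_of_isConvex {V : Triple} (hV : IsConvex V) (d : ℕ) :
    typeDegree d V = ∑ k ∈ Finset.Icc 1 (d - 1), radialCount V k := by
  refine Finset.sum_congr rfl fun k hk => ?_
  rw [transverseCount_of_isConvex hV (Finset.mem_Icc.1 hk).1, add_zero]

theorem folType_of_isConvex {V : Triple} (hV : IsConvex V) (d : ℕ) :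
    folType d V = ∑ k ∈ Finset.Icc 1 (d - 1), (radialCount V k : MvPolynomial (ℕ ⊕ ℕ) ℤ) * R k := by
  refine Finset.sum_congr rfl fun k hk => ?_
  rw [transverseCount_of_isConvex hV (Finset.mem_Icc.1 hk).1, Nat.cast_zero, zero_mul, add_zero]

theorem ThreeCritical.isConvex {d : ℕ} {A B : Binary} {p : Fin 3 → Fin 2 → ℂ} {k : Fin 3 → ℕ}
    (h : ThreeCritical d A B p k) : IsConvex (affineForm A B) := by
  have hd := h.degree_ge
  refine isConvex_affineForm (by omega) h.homA h.homB h.relPrime h.jac_ne_zero fun u hu hu0 => ?_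
  obtain ⟨i, hi⟩ := h.root u hu hu0
  rw [eval_fixForm_self]
  refine eval_eq_zero_of_wedge_eq_zero (isHomogeneous_fixedPoints h.homA h.homB)
    (ne_zero_of_indep h.indep i) hi ?_
  rw [← eval_fixForm_self]
  exact eval_eq_zero_of_lineThrough_dvd ((dvd_pow_self _ (by omega)).trans (h.order i).1)

theorem ThreeCritical.mem_Icc {d : ℕ} {A B : Binary} {p : Fin 3 → Fin 2 → ℂ} {k : Fin 3 → ℕ}
    (h : ThreeCritical d A B p k) (i : Fin 3) : k i ∈ Finset.Icc 1 (d - 1) := by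
  have h1 := (h.order i).lt_degree h.homA h.homB
  have h2 := h.pos i
  rw [Finset.mem_Icc]
  omega

theorem ThreeCritical.isHomConvexType3 {d : ℕ} {A B : Binary} {p : Fin 3 → Fin 2 → ℂ}
    {k : Fin 3 → ℕ} (h : ThreeCritical d A B p k) : IsHomConvexType3 d (affineForm A B) := by
  have hd := h.degree_ge
  refine ⟨isFoliation_affineForm (by omega) h.homA h.homB h.relPrime,
    ⟨A, B, h.homA, h.homB, h.relPrime, conj_equivalence.refl _⟩, h.isConvex, ?_⟩
  rw [typeDegree_of_isConvex h.isConvex]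
  simp only [radialCount_of_conj h (conj_equivalence.refl _)]
  rw [Finset.sum_comm]
  simp only [Finset.sum_ite_eq, h.mem_Icc, if_true]
  simp

theorem ThreeCritical.folType_eq {d : ℕ} {A B : Binary} {p : Fin 3 → Fin 2 → ℂ}
    {k : Fin 3 → ℕ} (h : ThreeCritical d A B p k) :
    folType d (affineForm A B) = ∑ i, R (k i) := by
  rw [folType_of_isConvex h.isConvex]
  simp only [radialCount_of_conj h (conj_equivalence.refl _), Nat.cast_sum, Finset.sum_mul,
    Nat.cast_ite, Nat.cast_one, Nat.cast_zero, ite_mul, one_mul, zero_mul]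
  rw [Finset.sum_comm]
  simp only [Finset.sum_ite_eq, h.mem_Icc, if_true]

/-- If it were zero, a zero of any independent combination of `A` and `B` would be a common zero. -/
theorem fixForm_ne_zero {A B : Binary} {d : ℕ} (hd : d ≠ 0) (hA : A.IsHomogeneous d)
    (hB : B.IsHomogeneous d) (hAB : IsRelPrime A B) {v : Fin 2 → ℂ} (hv : v ≠ 0) :
    fixForm A B v ≠ 0 := by
  intro h
  obtain ⟨w, hw⟩ := exists_wedge_ne_zero hv
  obtain ⟨e, rfl⟩ := Nat.exists_eq_succ_of_ne_zero hd
  obtain ⟨u, hu, hu0⟩ := exists_zero_of_isHomogeneous (isHomogeneous_fixForm hA hB w)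
  obtain ⟨hA0, hB0⟩ := eval_eq_zero_of_fixForm hw (h ▸ map_zero _) hu0
  exact no_common_zero_of_isRelPrime hA hB hAB hu hA0 hB0

/-- Homogeneous convex foliations with type of degree three have exactly three critical points. -/
theorem exists_threeCritical {d : ℕ} (hd : 2 ≤ d) {V : Triple} (hV : IsHomConvexType3 d V) :
    ∃ A B p k, ThreeCritical d A B p k ∧ Conj (affineForm A B) V := by
  classical
  obtain ⟨-, ⟨A, B, hA, hB, hAB, hconj⟩, hconv, hdeg⟩ := hV
  obtain ⟨M, N, c, e, hMN, hNM, -, h1, h2⟩ := hconj.exists_conjBy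
  have hd0 : d ≠ 0 := by omega
  -- The fixed-point form has degree `d + 1`, so a fixed point exists.
  have hJ : jac A B ≠ 0 := by
    have hC := isHomogeneous_fixedPoints hA hB
    rw [add_comm 1 d] at hC
    obtain ⟨v, hv, hv0⟩ := exists_zero_of_isHomogeneous hC
    exact jac_ne_zero hd0 hA hB hv (no_common_zero_of_isRelPrime hA hB hAB hv)
      (fixForm_ne_zero hd0 hA hB hAB hv) (by rw [eval_fixForm_self, hv0])
  have hfix : ∀ u : Fin 2 → ℂ, u ≠ 0 → eval u (jac A B) = 0 → eval u (fixForm A B u) = 0 := by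
    intro u hu hu0
    rw [← isInvariantCurve_lineThrough_iff hA hB hu]
    refine isInvariantCurve_of_conj hconj (isHomogeneous_affineForm hA hB) hconv
      (isHomogeneous_lineThrough u).rename_isHomogeneous
      (irreducible_extend_lineThrough hu).ne_zero ?_
    have hdu : IsUnit (C (d : ℂ) : MvPolynomial (Fin 3) ℂ) :=
      isUnit_C_of_ne_zero (by exact_mod_cast hd0)
    rw [← hdu.dvd_mul_left, inflection_affineForm hA hB, dvd_neg]
    refine Dvd.dvd.mul_left ?_ _
    rw [map_mul]
    exact Dvd.dvd.mul_left
      (map_dvd extend (lineThrough_dvd_of_eval_eq_zero (isHomogeneous_jac hA hB) hu hu0)) _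
  have hrad : ∀ (s : Projectivization ℂ (Fin 3 → ℂ)) (n : ℕ), IsRadial V s.rep n ↔
      1 ≤ n ∧ (M *ᵥ s.rep) 2 = 0 ∧ HasOrder A B (trunc (M *ᵥ s.rep)) n := by
    intro s n
    rw [isRadial_iff_of_conjBy hMN hNM h1 h2,
      isRadial_affineForm_iff hd hA hB hAB (mulVec_ne_zero hNM s.rep_nonzero)]
  set S : Set (Projectivization ℂ (Fin 3 → ℂ)) := {s | ∃ n, IsRadial V s.rep n} with hS
  have hSfin : S.Finite := by
    refine (finite_setOf_root hNM (isHomogeneous_jac hA hB) hJ).subset ?_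
    rintro s ⟨n, hn⟩
    obtain ⟨hn1, hs2, hs⟩ := (hrad s n).1 hn
    exact ⟨hs2, hs.eval_jac_eq_zero
      (trunc_ne_zero (mulVec_ne_zero hNM s.rep_nonzero) hs2) hn1⟩
  -- A radial singularity has a single order, between `1` and `d - 1`, so the degree of the type
  -- counts each of them once.
  have hcard : S.ncard = 3 := by
    rw [typeDegree_of_isConvex hconv] at hdeg
    refine Eq.trans ?_ hdeg
    rw [Set.ncard_eq_toFinset_card S hSfin]
    have hcount : ∀ n, radialCount V n =
        ∑ s ∈ hSfin.toFinset, if IsRadial V s.rep n then 1 else 0 := by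
      intro n
      rw [radialCount, Finset.sum_boole, Nat.cast_id, ← Set.ncard_coe_finset]
      refine congrArg Set.ncard ?_
      ext s
      simp only [Set.mem_ofPred_eq, Finset.coe_filter, Set.Finite.mem_toFinset, hS]
      exact ⟨fun h => ⟨⟨n, h⟩, h⟩, fun h => h.2⟩
    simp only [hcount]
    rw [Finset.sum_comm, Finset.card_eq_sum_ones]
    refine Finset.sum_congr rfl fun s hs => ?_
    obtain ⟨n, hn⟩ : s ∈ S := by simpa using hs
    obtain ⟨hn1, hs2, hsn⟩ := (hrad s n).1 hn
    have hlt := hsn.lt_degree hA hB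
    rw [Finset.sum_eq_single n]
    · rw [if_pos hn]
    · intro m _ hm
      rw [if_neg]
      intro hm'
      exact hm (((hrad s m).1 hm').2.2.unique hsn)
    · intro hmem
      rw [Finset.mem_Icc] at hmem
      omega
  obtain ⟨x, y, z, hxy, hxz, hyz, hSeq⟩ := Set.ncard_eq_three.1 hcard
  set t : Fin 3 → Projectivization ℂ (Fin 3 → ℂ) := ![x, y, z]
  have htS : ∀ i, t i ∈ S := by
    intro i
    rw [hSeq]
    fin_cases i <;> simp [t]
  have htsurj : ∀ s ∈ S, ∃ i, t i = s := by
    intro s hs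
    rw [hSeq] at hs
    rcases hs with rfl | rfl | rfl
    · exact ⟨0, rfl⟩
    · exact ⟨1, rfl⟩
    · exact ⟨2, rfl⟩
  have htne : ∀ i j, i ≠ j → t i ≠ t j := by
    intro i j hij
    fin_cases i <;> fin_cases j <;> simp [t, hxy, hxz, hyz, hxy.symm, hxz.symm, hyz.symm] at hij ⊢
  choose k hk using htS
  have hk' := fun i => (hrad (t i) (k i)).1 (hk i)
  have hpne : ∀ i, trunc (M *ᵥ (t i).rep) ≠ 0 := fun i =>
    trunc_ne_zero (mulVec_ne_zero hNM (t i).rep_nonzero) (hk' i).2.1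
  refine ⟨A, B, fun i => trunc (M *ᵥ (t i).rep), k,
    threeCritical_of_hasOrder hd0 hA hB hAB ?_ (fun i => (hk' i).1) (fun i => (hk' i).2.2) ?_,
    hconj⟩
  · intro i j hij hw
    apply htne j i hij.symm
    obtain ⟨a, ha⟩ := exists_smul_of_wedge_eq_zero (hpne i) hw
    have h3 : M *ᵥ (t j).rep = M *ᵥ (a • (t i).rep) := by
      rw [← atInfinity_trunc (hk' j).2.1, ha, atInfinity_smul, atInfinity_trunc (hk' i).2.1,
        Matrix.mulVec_smul]
    have h4 := congrArg (N *ᵥ ·) h3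
    simp only [Matrix.mulVec_mulVec, hNM, Matrix.one_mulVec] at h4
    rw [← (t i).mk_rep, ← (t j).mk_rep, Projectivization.mk_eq_mk_iff']
    exact ⟨a, h4.symm⟩
  · intro u hu hu0
    -- By convexity the critical point `u` is fixed, so it has an order `n`; `n = 0` would make the
    -- Jacobian nonzero at `u`. Hence `u` is a radial singularity, one of the three.
    obtain ⟨n, hn⟩ := exists_hasOrder hA hB hu (fixForm_ne_zero hd0 hA hB hAB hu) (hfix u hu hu0)
    have hn1 : 1 ≤ n := by
      by_contra hn0
      obtain rfl : n = 0 := by omega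
      apply not_lineThrough_pow_succ_dvd_jac hd0 hA hB hu
        (no_common_zero_of_isRelPrime hA hB hAB hu) hn
      rw [zero_add, pow_one]
      exact lineThrough_dvd_of_eval_eq_zero (isHomogeneous_jac hA hB) hu hu0
    have hq : N *ᵥ atInfinity u ≠ 0 := mulVec_ne_zero hMN (atInfinity_ne_zero hu)
    obtain ⟨a, ha⟩ := Projectivization.exists_smul_eq_mk_rep ℂ _ hq
    have hrep : M *ᵥ (Projectivization.mk ℂ _ hq).rep = atInfinity ((a : ℂ) • u) := by
      rw [← ha, Units.smul_def, Matrix.mulVec_smul, Matrix.mulVec_mulVec, hMN, Matrix.one_mulVec,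
        atInfinity_smul]
    obtain ⟨i, hi⟩ := htsurj (Projectivization.mk ℂ _ hq) ⟨n, (hrad _ n).2 ⟨hn1, by
      rw [hrep, trunc_atInfinity, hasOrder_smul_iff A B a.ne_zero]
      exact ⟨rfl, hn⟩⟩⟩
    refine ⟨i, ?_⟩
    simp only [hi, hrep, trunc_atInfinity]
    rw [wedge_comm, wedge_smul_right, wedge_self, mul_zero, neg_zero]

/-! ## Classification and count -/

theorem ThreeCritical.comp_perm {d : ℕ} {A B : Binary} {p : Fin 3 → Fin 2 → ℂ} {k : Fin 3 → ℕ}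
    (h : ThreeCritical d A B p k) (σ : Equiv.Perm (Fin 3)) :
    ThreeCritical d A B (p ∘ σ) (k ∘ σ) where
  homA := h.homA
  homB := h.homB
  relPrime := h.relPrime
  indep i j hij := h.indep _ _ (σ.injective.ne hij)
  order i := h.order (σ i)
  pos i := h.pos (σ i)
  sum := by
    rw [← h.sum]
    exact congrArg (· + 2) (Equiv.sum_comp σ k)
  root u hu hu0 := by
    obtain ⟨i, hi⟩ := h.root u hu hu0
    exact ⟨σ.symm i, by simpa using hi⟩

/-- The parameters of the normal forms. -/
def Admissible (d l ν : ℕ) : Prop := 1 ≤ l ∧ 1 ≤ ν ∧ 2 * l ≤ ν + 2 ∧ 2 * ν + 2 ≤ d + l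

theorem Admissible.threeCritical {d l ν : ℕ} (h : Admissible d l ν) :
    ThreeCritical d (polyC d l ν) (polyD d l ν) stdPoint ![d + l - 2 - ν, d - l, ν] :=
  threeCritical_polyC_polyD h.1 h.2.1 h.2.2.1 h.2.2.2

/-- Sort the multiplicities: the smallest is `ν`, the largest is `d - l`, and the total `2d - 2`
determines the middle one. -/
theorem exists_admissible_conj {d : ℕ} {V : Triple} (hd : 2 ≤ d) (hV : IsHomConvexType3 d V) :
    ∃ l ν, Admissible d l ν ∧ Conj (omega₂ d l ν) V := by
  obtain ⟨A, B, p, k, h, hconj⟩ := exists_threeCritical hd hV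
  have hmono := Tuple.monotone_sort k
  -- The normal form lists the multiplicities as middle, largest, smallest.
  have h' := h.comp_perm ((finRotate 3).trans (Tuple.sort k))
  set q := k ∘ Tuple.sort k with hq
  have h01 : q 0 ≤ q 1 := hmono (by decide)
  have h12 : q 1 ≤ q 2 := hmono (by decide)
  have e : k ∘ ((finRotate 3).trans (Tuple.sort k)) = ![q 1, q 2, q 0] := by
    funext i; fin_cases i <;> rfl
  rw [e] at h'
  have hsum := h'.sum
  rw [Fin.sum_univ_three] at hsum
  change q 1 + q 2 + q 0 + 2 = 2 * d at hsum
  have hpos : 1 ≤ q 0 := h'.pos 2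
  have hlt : q 2 < d := (h'.order 1).lt_degree h.homA h.homB
  have hadm : Admissible d (d - q 2) (q 0) := by
    refine ⟨?_, ?_, ?_, ?_⟩ <;> omega
  refine ⟨_, _, hadm, conj_equivalence.trans (h'.conj ?_) hconj⟩
  have h₀ := hadm.threeCritical
  rwa [show d + (d - q 2) - 2 - q 0 = q 1 by omega, show d - (d - q 2) = q 2 by omega] at h₀

theorem omega₁_eq_omega₂ {d l : ℕ} (hl : 2 ≤ l) (hd : 2 * l ≤ d + 1) :
    omega₁ d l = omega₂ d l (2 * l - 2) := by
  obtain ⟨l, rfl⟩ := Nat.exists_eq_add_of_le' (show 1 ≤ l by omega)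
  rw [omega₁, omega₂, polyA_eq_polyC d l (by omega) (by omega), polyB_eq_polyD,
    show 2 * (l + 1) - 2 = 2 * l by omega]

theorem Admissible.isHomConvexType3 {d l ν : ℕ} (h : Admissible d l ν) :
    IsHomConvexType3 d (omega₂ d l ν) :=
  h.threeCritical.isHomConvexType3

theorem Admissible.folType_eq {d l ν : ℕ} (h : Admissible d l ν) :
    folType d (omega₂ d l ν) = R (d + l - 2 - ν) + R (d - l) + R ν := by
  rw [omega₂, h.threeCritical.folType_eq, Fin.sum_univ_three]
  rfl

theorem exists_eq_of_sum_ite_eq {k k' : Fin 3 → ℕ}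
    (h : ∀ n, (∑ i, if k i = n then 1 else 0) = ∑ i, if k' i = n then 1 else 0) (i : Fin 3) :
    k' 0 = k i ∨ k' 1 = k i ∨ k' 2 = k i := by
  by_contra! hcon
  have h1 := h (k i)
  rw [Fin.sum_univ_three fun j => if k' j = k i then 1 else 0, if_neg hcon.1, if_neg hcon.2.1,
    if_neg hcon.2.2] at h1
  have h2 := Finset.sum_eq_zero_iff.1 h1 i (Finset.mem_univ i)
  simp at h2

/-- The multiset of radial orders is invariant, and admissibility makes `ν` its minimum and `d - l`
its maximum. -/
theorem Admissible.eq_of_conj {d l ν l' ν' : ℕ} (h : Admissible d l ν) (h' : Admissible d l' ν')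
    (hc : Conj (omega₂ d l ν) (omega₂ d l' ν')) : l = l' ∧ ν = ν' := by
  have hsum : ∀ n, (∑ i, if ![d + l - 2 - ν, d - l, ν] i = n then 1 else 0) =
      ∑ i, if ![d + l' - 2 - ν', d - l', ν'] i = n then 1 else 0 := fun n =>
    (radialCount_of_conj h.threeCritical hc n).symm.trans
      (radialCount_of_conj h'.threeCritical (conj_equivalence.refl _) n)
  have k1 := exists_eq_of_sum_ite_eq hsum 2
  have k2 := exists_eq_of_sum_ite_eq (fun n => (hsum n).symm) 2
  have k3 := exists_eq_of_sum_ite_eq hsum 1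
  have k4 := exists_eq_of_sum_ite_eq (fun n => (hsum n).symm) 1
  simp only [Matrix.cons_val_zero, Matrix.cons_val_one, Matrix.cons_val] at k1 k2 k3 k4
  obtain ⟨a1, a2, a3, a4⟩ := h
  obtain ⟨b1, b2, b3, b4⟩ := h'
  omega

/-! ### Counting the parameters -/

/-- The admissible parameters with `ν = 2 l - 2`, and the others. -/
def paramFinset (d : ℕ) : Finset (Σ _ : ℕ, ℕ) :=
  ((Finset.Icc 2 ((d + 2) / 3)).sigma fun l => {2 * l - 2}) ∪
    (Finset.Icc 1 (d / 3)).sigma fun l => Finset.Icc (2 * l - 1) ((d + l - 2) / 2)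

theorem mem_paramFinset {d : ℕ} (hd : 3 ≤ d) (q : Σ _ : ℕ, ℕ) :
    q ∈ paramFinset d ↔ Admissible d q.1 q.2 := by
  obtain ⟨l, ν⟩ := q
  simp only [paramFinset, Finset.mem_union, Finset.mem_sigma, Finset.mem_Icc, Finset.mem_singleton,
    Admissible]
  omega

theorem card_paramFinset {d : ℕ} (hd : 3 ≤ d) : (paramFinset d).card = numN d := by
  rw [paramFinset, Finset.card_union_of_disjoint, Finset.card_sigma, Finset.card_sigma]
  · have h1 : ∑ l ∈ Finset.Icc 1 (d / 3), (Finset.Icc (2 * l - 1) ((d + l - 2) / 2)).card =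
        ∑ l ∈ Finset.Icc 1 (d / 3), (d - 3 * l + 2) / 2 := by
      refine Finset.sum_congr rfl fun l hl => ?_
      rw [Finset.mem_Icc] at hl
      rw [Nat.card_Icc]
      omega
    rw [h1, numN]
    simp only [Finset.card_singleton, Finset.sum_const, smul_eq_mul, mul_one, Nat.card_Icc]
    generalize ∑ l ∈ Finset.Icc 1 (d / 3), (d - 3 * l + 2) / 2 = s
    -- The boundary family has `⌊(d+2)/3⌋ - 1` members, which is `⌊(d+1)/3⌋` when `d ≡ 1` modulo 3
    -- and one less otherwise.
    split_ifs <;> omega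
  · rw [Finset.disjoint_left]
    rintro ⟨l, ν⟩ h1 h2
    simp only [Finset.mem_sigma, Finset.mem_Icc, Finset.mem_singleton] at h1 h2
    omega

theorem card_conjClassesType3 {d : ℕ} (hd : 3 ≤ d) : Nat.card (ConjClassesType3 d) = numN d := by
  rw [← card_paramFinset hd, ← Nat.card_eq_finsetCard]
  symm
  refine Nat.card_eq_of_bijective (fun q : paramFinset d => (Quotient.mk _
    ⟨omega₂ d q.1.1 q.1.2, ((mem_paramFinset hd q.1).1 q.2).isHomConvexType3⟩ :
      ConjClassesType3 d)) ⟨?_, ?_⟩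
  · rintro ⟨⟨l, ν⟩, hq⟩ ⟨⟨l', ν'⟩, hq'⟩ heq
    have hc : Conj (omega₂ d l ν) (omega₂ d l' ν') := Quotient.exact heq
    obtain ⟨rfl, rfl⟩ := ((mem_paramFinset hd _).1 hq).eq_of_conj ((mem_paramFinset hd _).1 hq') hc
    rfl
  · intro c
    obtain ⟨⟨V, hV⟩, rfl⟩ := Quotient.exists_rep c
    obtain ⟨l, ν, hadm, hc⟩ := exists_admissible_conj (by omega) hV
    exact ⟨⟨⟨l, ν⟩, (mem_paramFinset hd _).2 hadm⟩, Quotient.sound hc⟩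

end ConvexFol

end

theorem theorem3p1 (d : ℕ) (hd : 3 ≤ d) :
    Nat.card (ConvexFol.ConjClassesType3 d) = ConvexFol.numN d ∧
    (∀ l : ℕ, 2 ≤ l → 3 * l ≤ d + 1 →
      ConvexFol.IsHomConvexType3 d (ConvexFol.omega₁ d l) ∧
      ConvexFol.folType d (ConvexFol.omega₁ d l) =
        ConvexFol.R (2 * l - 2) + 2 * ConvexFol.R (d - l)) ∧
    (∀ l : ℕ, d + 2 = 3 * l →
      ConvexFol.IsHomConvexType3 d (ConvexFol.omega₁ d l) ∧
      ConvexFol.folType d (ConvexFol.omega₁ d l) = 3 * ConvexFol.R (d - l)) ∧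
    (∀ l ν : ℕ, 1 ≤ l → 3 * l ≤ d → 2 * l ≤ ν + 1 → 2 * ν + 2 ≤ d + l →
      ConvexFol.IsHomConvexType3 d (ConvexFol.omega₂ d l ν) ∧
      ConvexFol.folType d (ConvexFol.omega₂ d l ν) =
        ConvexFol.R ν + ConvexFol.R (d + l - 2 - ν) + ConvexFol.R (d - l)) ∧
    (∀ V : ConvexFol.Triple, ConvexFol.IsHomConvexType3 d V →
      (∃ l : ℕ, ((2 ≤ l ∧ 3 * l ≤ d + 1) ∨ d + 2 = 3 * l) ∧
        ConvexFol.Conj (ConvexFol.omega₁ d l) V) ∨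
      (∃ l ν : ℕ, 1 ≤ l ∧ 3 * l ≤ d ∧ 2 * l ≤ ν + 1 ∧ 2 * ν + 2 ≤ d + l ∧
        ConvexFol.Conj (ConvexFol.omega₂ d l ν) V)) := by
  open ConvexFol in
  refine ⟨card_conjClassesType3 hd, ?_, ?_, ?_, ?_⟩
  · intro l h1 h2
    have hadm : Admissible d l (2 * l - 2) := by refine ⟨?_, ?_, ?_, ?_⟩ <;> omega
    rw [omega₁_eq_omega₂ h1 (by omega)]
    refine ⟨hadm.isHomConvexType3, ?_⟩
    rw [hadm.folType_eq, show d + l - 2 - (2 * l - 2) = d - l by omega]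
    ring
  · intro l h1
    have hadm : Admissible d l (2 * l - 2) := by refine ⟨?_, ?_, ?_, ?_⟩ <;> omega
    rw [omega₁_eq_omega₂ (by omega) (by omega)]
    refine ⟨hadm.isHomConvexType3, ?_⟩
    rw [hadm.folType_eq, show d + l - 2 - (2 * l - 2) = d - l by omega,
      show 2 * l - 2 = d - l by omega]
    ring
  · intro l ν h1 h2 h3 h4
    have hadm : Admissible d l ν := by refine ⟨?_, ?_, ?_, ?_⟩ <;> omega
    refine ⟨hadm.isHomConvexType3, ?_⟩
    rw [hadm.folType_eq]
    ring
  · intro V hV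
    obtain ⟨l, ν, hadm, hc⟩ := exists_admissible_conj (by omega) hV
    have ⟨a1, a2, a3, a4⟩ := hadm
    -- Equality in `2l ≤ ν + 2` is the first family, including the case `d = 3l - 2` of three equal
    -- orders.
    by_cases hν : ν + 2 = 2 * l
    · left
      refine ⟨l, by omega, ?_⟩
      rw [omega₁_eq_omega₂ (by omega) (by omega), show 2 * l - 2 = ν by omega]
      exact hc
    · right
      exact ⟨l, ν, by omega, by omega, by omega, by omega, hc⟩
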